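/- A commutative local ring is called uniserial if, as a module over itself, it has a unique composition series; its Loewy length is the least $n$ with $\mathfrak m^n=0$, where $\mathfrak m$ is its maximal ideal. Let $\Lambda$ and $\Gamma$ be commutative local uniserial rings of the same Loewy length $n\le 3$ and with isomorphic residue fields (for example $\mathbb Z/(p^3)$ and $\mathbb F_p[x]/(x^3)$), and let $Q$ be a finite acyclic quiver with vertex set $Q_0$ and arrow set $Q_1$. For $R\in\{\Lambda,\Gamma\}$, let $\operatorname{mono}_Q(R)$ be the full subcategory of the category of representations of $Q$ in finitely generated $R$-modules consisting of those $M=(M_i,M_\alpha)_{i\in Q_0,\alpha\in Q_1}$ for which the map $$\bigoplus_{\alpha\in Q_1,\ t(\alpha)=i} M_{s(\alpha)}\xrightarrow{(M_\alpha)_\alpha} M_i$$ is injective for every vertex $i$, where $s(\alpha)$ and $t(\alpha)$ denote the source and target of $\alpha$. Every finitely generated $R$-module is isomorphic to $R/\mathfrak m^{a_1}\oplus\dots\oplus R/\mathfrak m^{a_s}$ for a unique partition $(a_1\ge\dots\ge a_s)$ with $n\ge a_1$ and $a_s\ge 1$ (empty for the zero module), where $\mathfrak m$ is the maximal ideal of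 $R$; the partition vector of $M$ is the tuple of the partitions of the modules $M_i$, $i\in Q_0$. Then there is a bijection between the isomorphism classes of indecomposable objects of $\operatorname{mono}_Q(\Lambda)$ and those of $\operatorname{mono}_Q(\Gamma)$ that preserves partition vectors. -/

import Mathlib

universe u v w w'

/-- A ring is uniserial if, as a module over itself, it has a unique composition series
`⊥ = I₀ ⋖ I₁ ⋖ ⋯ ⋖ Iₗ = ⊤`. -/
def IsUniserialRing (R : Type u) [CommRing R] : Prop :=
  ∃! s : CompositionSeries (Submodule R R), s.head = ⊥ ∧ s.last = ⊤

/-- The Loewy length of an artinian ring: the least `n` such that the `n`-th power of the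
(nilpotent) Jacobson radical vanishes. -/
noncomputable def loewyLength (R : Type u) [CommRing R] : ℕ :=
  sInf {n : ℕ | Ring.jacobson R ^ n = ⊥}

/-- The list `α = (α₁ ≥ α₂ ≥ ⋯ ≥ αₛ)`, with `1 ≤ αₖ ≤ loewyLength R`, is the partition of the
`R`-module `M`: `M ≅ R/𝔪^α₁ ⊕ ⋯ ⊕ R/𝔪^αₛ`, with `𝔪` the maximal ideal of `R`. -/
def HasPartition (R : Type u) [CommRing R] [IsLocalRing R]
    (M : Type v) [AddCommGroup M] [Module R M] (α : List ℕ) : Prop :=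
  α.Pairwise (· ≥ ·) ∧ (∀ a ∈ α, 1 ≤ a ∧ a ≤ loewyLength R) ∧
    Nonempty (M ≃ₗ[R] ∀ k : Fin α.length, R ⧸ IsLocalRing.maximalIdeal R ^ α.get k)

/-- A quiver is acyclic if every oriented path from a vertex to itself is trivial. -/
def Quiver.IsAcyclic (Q : Type w) [Quiver.{w'} Q] : Prop :=
  ∀ (i : Q) (p : Quiver.Path i i), p.length = 0

/-- Representations of a quiver `Q` in finitely generated `R`-modules. The modules are taken in the
universe of `R`, where every finitely generated `R`-module has an isomorphic copy. -/
structure QuiverRep (Q : Type w) [Quiver.{w'} Q] (R : Type u) [CommRing R] where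
  obj : Q → Type u
  [addCommGroup : ∀ i, AddCommGroup (obj i)]
  [module : ∀ i, Module R (obj i)]
  [finite : ∀ i, Module.Finite R (obj i)]
  map : ∀ {i j : Q}, (i ⟶ j) → obj i →ₗ[R] obj j

namespace QuiverRep

attribute [instance] QuiverRep.addCommGroup QuiverRep.module QuiverRep.finite

section

variable {Q : Type w} [Quiver.{w'} Q] {R : Type u} [CommRing R]

/-- Isomorphisms of representations. -/
structure Iso (M N : QuiverRep Q R) where
  equiv : ∀ i, M.obj i ≃ₗ[R] N.obj i
  comm : ∀ {i j : Q} (a : i ⟶ j) (x : M.obj i), equiv j (M.map a x) = N.map a (equiv i x)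

/-- The direct sum of two representations. -/
def directSum (M N : QuiverRep Q R) : QuiverRep Q R where
  obj i := M.obj i × N.obj i
  map a := (M.map a).prodMap (N.map a)

/-- The zero representations. -/
def IsZero (M : QuiverRep Q R) : Prop :=
  ∀ i, Subsingleton (M.obj i)

variable [Fintype Q] [∀ i j : Q, Fintype (i ⟶ j)]

/-- The map `⨁_{a : j ⟶ i} M j ⟶ M i`, over all arrows `a` with target `i`, with components
`M.map a`. -/
def inMap (M : QuiverRep Q R) (i : Q) :
    (∀ a : (Σ j : Q, (j ⟶ i)), M.obj a.1) →ₗ[R] M.obj i :=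
  ∑ a : (Σ j : Q, (j ⟶ i)), (M.map a.2).comp (LinearMap.proj a)

/-- Membership in the (separated) monomorphism category. -/
def IsMono (M : QuiverRep Q R) : Prop :=
  ∀ i, Function.Injective (M.inMap i)

/-- Indecomposable objects of the monomorphism category. -/
def IsIndecomposableMono (M : QuiverRep Q R) : Prop :=
  M.IsMono ∧ ¬ M.IsZero ∧
    ∀ A B : QuiverRep Q R, A.IsMono → B.IsMono → Nonempty (M.Iso (A.directSum B)) →
      A.IsZero ∨ B.IsZero

end

variable (Q : Type w) [Quiver.{w'} Q] [Fintype Q] [∀ i j : Q, Fintype (i ⟶ j)]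
  (R : Type u) [CommRing R]

/-- Isomorphism as an equivalence relation on the indecomposable objects of the monomorphism
category. -/
def indecMonoSetoid : Setoid {M : QuiverRep Q R // M.IsIndecomposableMono} where
  r M N := Nonempty (M.1.Iso N.1)
  iseqv :=
    { refl := fun _ => ⟨⟨fun _ => LinearEquiv.refl R _, fun _ _ => rfl⟩⟩
      symm := fun ⟨e⟩ => ⟨⟨fun i => (e.equiv i).symm, fun a x => by
        rw [LinearEquiv.symm_apply_eq, e.comm, LinearEquiv.apply_symm_apply]⟩⟩
      trans := fun ⟨e⟩ ⟨f⟩ => ⟨⟨fun i => (e.equiv i).trans (f.equiv i), fun a x => by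
        simp only [LinearEquiv.trans_apply, e.comm, f.comm]⟩⟩ }

/-- Isomorphism classes of indecomposable objects of the monomorphism category. -/
def IndecMono : Type _ :=
  Quotient (indecMonoSetoid Q R)

variable {Q R}

/-- `α = (αⁱ)ᵢ` is the partition vector of the isomorphism class `x`: for a representation `M` in
the class, `αⁱ` is the partition of `M i` for every vertex `i`. -/
def IndecMono.HasPartitionVector [IsLocalRing R] (x : IndecMono Q R) (α : Q → List ℕ) : Prop :=
  ∃ M : {M : QuiverRep Q R // M.IsIndecomposableMono},
    Quotient.mk (indecMonoSetoid Q R) M = x ∧ ∀ i, HasPartition R (M.1.obj i) (α i)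

end QuiverRep

universe u' v'

/-! ### Chain rings -/

section Uniserial

variable {R : Type u} [CommRing R]

/-! The maximal ideal is generated by some `ϖ`, every nonzero ideal is a power of it, and `R` is
injective over itself. Every finitely generated module is therefore a sum of cyclic modules `R/ϖ^a`,
and free modules are also injective. Modulo maps that factor through free modules, a module `M` is
seen by `A = M[ϖ]/ϖ^(n-1)M` and `B = M[ϖ²]/ϖ^(n-2)M`, that is, by the stable maps from `R/ϖ` and
`R/ϖ²` to `M`, together with the map `ι : A → B` induced by inclusion and the map `p : B → A`
induced by multiplication by `ϖ`. For `n ≤ 3` both are vector spaces over the residue field `k`,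
since `ϖ M[ϖ²] ⊆ ϖ^(n-2)M`. The stable picture thus depends on `k` and `n` only, not on `R`.

To a representation in the monomorphism category one attaches these data at each vertex, the linear
maps induced by the arrows, and at each vertex `i` one more space `Z i`, identified with `ϖ^(n-1)`
times the cokernel of the incoming map; its dimension counts the free summands of that cokernel.

These invariants are complete (`IsChainRing.nonempty_iso`). Going up the acyclic quiver, an
isomorphism on the incoming sum is extended to the vertex by `IsChainRing.exists_injective_lift`:
lift the stable map, correct it by a map through a free module until the square commutes, then
correct it by another one until it is right on `Z`. They are also arbitrary, subject to linear
conditions that mention only `k` and `n` (`IsChainRing.exists_isMono_repMarking`): add to a module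
without free summands a free module large enough to make the incoming map injective, and a further
free summand for `Z`.

Matching invariants therefore matches isomorphism classes over the two rings. It respects direct
sums and zero objects, hence indecomposability. Partitions also match: the number of parts `≥ b` is
expressed by dimensions of invariants and the free rank of the module (`IsChainRing.countP_eq`), and
the free ranks satisfy a recursion along the quiver with coefficients in the invariants
(`IsChainRing.hasDim_powMultiples_eq`). -/

theorem exists_compositionSeries_through [IsNoetherianRing R] [IsArtinianRing R]
    (I : Submodule R R) :
    ∃ s : CompositionSeries (Submodule R R), s.head = ⊥ ∧ s.last = ⊤ ∧ I ∈ s := by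
  obtain ⟨a, ha0, m, ham, ha⟩ :=
    exists_covBy_seq_of_wellFoundedLT_wellFoundedGT_of_le (bot_le : (⊥ : Submodule R R) ≤ I)
  obtain ⟨b, hb0, l, hbl, hb⟩ :=
    exists_covBy_seq_of_wellFoundedLT_wellFoundedGT_of_le (le_top : I ≤ (⊤ : Submodule R R))
  let c : ℕ → Submodule R R := fun i => if i ≤ m then a i else b (i - m)
  refine ⟨⟨m + l, fun i => c i, ?_⟩, ?_, ?_, ?_⟩
  · intro i
    change c i ⋖ c (i + 1)
    have hi := i.2
    rcases lt_trichotomy (i : ℕ) m with h | h | h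
    · simp only [c, if_pos h.le, if_pos (Nat.succ_le_of_lt h)]
      exact ha _ h
    · have h1 : ¬ (m + 1 ≤ m) := by omega
      have := hb 0 (by omega)
      simp only [c, h, le_refl, if_true, if_neg h1, ham, Nat.add_sub_cancel_left]
      simpa [hb0] using this
    · have h1 : ¬ ((i : ℕ) ≤ m) := by omega
      have h2 : ¬ ((i : ℕ) + 1 ≤ m) := by omega
      have h3 : (i : ℕ) + 1 - m = (i - m) + 1 := by omega
      simp only [c, if_neg h1, if_neg h2, h3]
      exact hb _ (by omega)
  · change c 0 = ⊥
    simp [c, ha0]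
  · change c (m + l) = ⊤
    rcases Nat.eq_zero_or_pos l with h | h
    · subst h; simp only [c, Nat.add_zero, le_refl, if_true]; rw [ham, ← hb0, hbl]
    · have : ¬ (m + l ≤ m) := by omega
      simp [c, if_neg this, hbl]
  · refine ⟨⟨m, by change m < m + l + 1; omega⟩, ?_⟩
    change c m = I
    simp [c, ham]

theorem IsUniserialRing.isNoetherianRing (h : IsUniserialRing R) : IsNoetherianRing R :=
  (isFiniteLength_iff_isNoetherian_isArtinian.mp
    (isFiniteLength_iff_exists_compositionSeries.mpr h.exists)).1

theorem IsUniserialRing.isArtinianRing (h : IsUniserialRing R) : IsArtinianRing R :=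
  (isFiniteLength_iff_isNoetherian_isArtinian.mp
    (isFiniteLength_iff_exists_compositionSeries.mpr h.exists)).2

/-- Every ideal is a term of some composition series; there is only one, and its terms form a chain.
-/
theorem IsUniserialRing.le_total (h : IsUniserialRing R) (I J : Ideal R) : I ≤ J ∨ J ≤ I := by
  have := h.isNoetherianRing
  have := h.isArtinianRing
  obtain ⟨s, hs1, hs2, hs⟩ := exists_compositionSeries_through I
  obtain ⟨t, ht1, ht2, ht⟩ := exists_compositionSeries_through J
  have hst : s = t := h.unique ⟨hs1, hs2⟩ ⟨ht1, ht2⟩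
  subst hst
  exact CompositionSeries.total hs ht

theorem IsUniserialRing.exists_eq_span (h : IsUniserialRing R) (I : Ideal R) :
    ∃ x, I = Ideal.span {x} := by
  have := h.isNoetherianRing
  refine Submodule.fg_induction (motive := fun I _ => ∃ x, I = Ideal.span {x})
    (fun x => ⟨x, rfl⟩) ?_ I (IsNoetherian.noetherian I)
  rintro I J - - ⟨x, hx⟩ ⟨y, hy⟩
  rcases h.le_total I J with hle | hle
  · exact ⟨y, by rw [sup_eq_right.mpr hle, hy]⟩
  · exact ⟨x, by rw [sup_eq_left.mpr hle, hx]⟩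

end Uniserial

/-- `R` is a local ring with maximal ideal `(ϖ)`, where `ϖ ^ n = 0 ≠ ϖ ^ (n - 1)`, and `ρ` realizes
`k` as its residue field. -/
structure IsChainRing (R : Type u) [CommRing R] [IsLocalRing R] {k : Type w} [Field k]
    (ϖ : R) (n : ℕ) (ρ : R →+* k) : Prop where
  noeth : IsNoetherianRing R
  artin : IsArtinianRing R
  surj : Function.Surjective ρ
  rho_eq_zero : ∀ r, ρ r = 0 ↔ ϖ ∣ r
  max_eq : IsLocalRing.maximalIdeal R = Ideal.span {ϖ}
  loewy : loewyLength R = n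
  pos : 1 ≤ n
  pow_eq : ϖ ^ n = 0
  pow_ne : ϖ ^ (n - 1) ≠ 0

theorem IsUniserialRing.exists_isChainRing {R : Type u} [CommRing R] [IsLocalRing R]
    (h : IsUniserialRing R) {k : Type w} [Field k] (e : IsLocalRing.ResidueField R ≃+* k) :
    ∃ ϖ : R, IsChainRing R ϖ (loewyLength R)
      ((e : IsLocalRing.ResidueField R →+* k).comp (IsLocalRing.residue R)) := by
  have := h.isNoetherianRing
  have := h.isArtinianRing
  obtain ⟨ϖ, hϖ⟩ := h.exists_eq_span (IsLocalRing.maximalIdeal R)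
  have hjac : Ring.jacobson R = Ideal.span {ϖ} := by
    rw [IsLocalRing.ringJacobson_eq_maximalIdeal, hϖ]
  have hpow : ∀ m, Ring.jacobson R ^ m = ⊥ ↔ ϖ ^ m = 0 := fun m => by
    rw [hjac, Ideal.span_singleton_pow, Ideal.span_singleton_eq_bot]
  have hne : {m : ℕ | Ring.jacobson R ^ m = ⊥}.Nonempty := by
    obtain ⟨m, hm⟩ := IsArtinianRing.isNilpotent_jacobson_bot (R := R)
    exact ⟨m, by simpa [Ideal.jacobson_bot] using hm⟩
  have hmem : Ring.jacobson R ^ loewyLength R = ⊥ := Nat.sInf_mem hne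
  have hpos : 1 ≤ loewyLength R := by
    by_contra hlt
    have h0 : loewyLength R = 0 := by omega
    rw [h0, hpow, pow_zero] at hmem
    exact one_ne_zero hmem
  refine ⟨ϖ, ‹_›, ‹_›, ?_, ?_, hϖ, rfl, hpos, (hpow _).1 hmem, ?_⟩
  · exact e.surjective.comp IsLocalRing.residue_surjective
  · intro r
    rw [← Ideal.mem_span_singleton, ← hϖ]
    simp [IsLocalRing.residue_eq_zero_iff]
  · intro h0
    have : loewyLength R ≤ loewyLength R - 1 := Nat.sInf_le ((hpow _).2 h0)
    omega

namespace IsChainRing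

variable {R : Type u} [CommRing R] [IsLocalRing R] {k : Type w} [Field k]
  {ϖ : R} {n : ℕ} {ρ : R →+* k} (hR : IsChainRing R ϖ n ρ)

include hR

theorem rho_pi : ρ ϖ = 0 := (hR.rho_eq_zero ϖ).2 dvd_rfl

theorem isUnit_of_not_dvd {r : R} (h : ¬ ϖ ∣ r) : IsUnit r := by
  by_contra hr
  have : r ∈ IsLocalRing.maximalIdeal R := hr
  rw [hR.max_eq, Ideal.mem_span_singleton] at this
  exact h this

theorem mem_max_pow {a : ℕ} {r : R} : r ∈ IsLocalRing.maximalIdeal R ^ a ↔ ϖ ^ a ∣ r := by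
  rw [hR.max_eq, Ideal.span_singleton_pow, Ideal.mem_span_singleton]

theorem pow_eq_zero_of_le {a : ℕ} (h : n ≤ a) : ϖ ^ a = 0 := by
  rw [← Nat.add_sub_cancel' h, pow_add, hR.pow_eq, zero_mul]

theorem pow_ne_zero_of_lt {a : ℕ} (h : a < n) : ϖ ^ a ≠ 0 := fun h0 => hR.pow_ne <| by
  rw [← Nat.add_sub_cancel' (show a ≤ n - 1 by omega), pow_add, h0, zero_mul]

theorem exists_unit_mul_pow (r : R) (hr : r ≠ 0) : ∃ a < n, ∃ s : R, IsUnit s ∧ r = s * ϖ ^ a := by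
  have hlt : ∀ a, ϖ ^ a ∣ r → a < n := by
    intro a ha
    by_contra hle
    rw [hR.pow_eq_zero_of_le (not_lt.1 hle)] at ha
    exact hr (zero_dvd_iff.1 ha)
  classical
  have hex : ∃ a, ¬ ϖ ^ (a + 1) ∣ r := ⟨n, fun h => by have := hlt _ h; omega⟩
  set a := Nat.find hex
  have h1 : ϖ ^ a ∣ r := by
    rcases Nat.eq_zero_or_pos a with h | h
    · rw [h, pow_zero]; exact one_dvd r
    · have := Nat.find_min hex (show a - 1 < a by omega)
      rwa [not_not, Nat.sub_add_cancel h] at this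
  obtain ⟨s, hs⟩ := h1
  refine ⟨a, hlt _ ⟨s, hs⟩, s, hR.isUnit_of_not_dvd ?_, by rw [hs, mul_comm]⟩
  rintro ⟨t, rfl⟩
  exact Nat.find_spec hex ⟨t, hs.trans (by rw [pow_succ, mul_assoc])⟩

/-- A nonzero `r` is a unit times a power of `ϖ`, so this is a comparison of exponents. -/
theorem dvd_of_pow_mul_eq_zero {a : ℕ} {r : R} (h : ϖ ^ a * r = 0) : ϖ ^ (n - a) ∣ r := by
  by_cases hr : r = 0
  · simp [hr]
  obtain ⟨b, hb, s, hs, rfl⟩ := hR.exists_unit_mul_pow r hr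
  have h0 : ϖ ^ (a + b) = 0 := by
    have : s * ϖ ^ (a + b) = 0 := by rw [← h]; ring
    exact (hs.mul_right_eq_zero).1 this
  have : n ≤ a + b := by
    by_contra hlt
    exact hR.pow_ne_zero_of_lt (by omega) h0
  exact Dvd.dvd.mul_left (pow_dvd_pow _ (by omega)) _

/-! ### Self-injectivity of chain rings -/

/-- A nonzero ideal is `(ϖ^a)`. The image of `ϖ^a` under a homomorphism to `R` is killed by
`ϖ^(n-a)`, hence is `ϖ^a c` for some `c`, and multiplication by `c` is the extension. -/
theorem baer : Module.Baer R R := by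
  intro I g
  by_cases hI : I = ⊥
  · subst hI
    refine ⟨0, fun x hx => ?_⟩
    have : (⟨x, hx⟩ : (⊥ : Ideal R)) = 0 := Subsingleton.elim _ _
    rw [this, map_zero, LinearMap.zero_apply]
  classical
  have hex : ∃ a, ϖ ^ a ∈ I := ⟨n, by rw [hR.pow_eq]; exact I.zero_mem⟩
  set a := Nat.find hex with ha
  have hmem : ϖ ^ a ∈ I := Nat.find_spec hex
  have hdvd : ∀ x ∈ I, ϖ ^ a ∣ x := by
    intro x hx
    by_cases hx0 : x = 0
    · simp [hx0]
    obtain ⟨b, _, s, hs, rfl⟩ := hR.exists_unit_mul_pow x hx0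
    have : ϖ ^ b ∈ I := (Ideal.unit_mul_mem_iff_mem I hs).1 hx
    exact Dvd.dvd.mul_left (pow_dvd_pow _ (Nat.find_min' hex this)) _
  have hk : ϖ ^ (n - a) * g ⟨ϖ ^ a, hmem⟩ = 0 := by
    rw [← smul_eq_mul, ← map_smul]
    have : ϖ ^ (n - a) • (⟨ϖ ^ a, hmem⟩ : I) = 0 := by
      ext
      simp only [Submodule.coe_smul, smul_eq_mul, ← pow_add, ZeroMemClass.coe_zero]
      exact hR.pow_eq_zero_of_le (by omega)
    rw [this, map_zero]
  have han : a ≤ n := Nat.find_min' hex (by rw [hR.pow_eq]; exact I.zero_mem)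
  obtain ⟨c, hc⟩ := hR.dvd_of_pow_mul_eq_zero hk
  rw [Nat.sub_sub_self han] at hc
  refine ⟨LinearMap.lsmul R R c, fun x hx => ?_⟩
  obtain ⟨t, rfl⟩ := hdvd x hx
  have : (⟨ϖ ^ a * t, hx⟩ : I) = t • ⟨ϖ ^ a, hmem⟩ := by
    ext; simp [mul_comm]
  rw [this, map_smul, hc]
  simp only [LinearMap.lsmul_apply, smul_eq_mul]
  ring

theorem extend {M N : Type*} [AddCommGroup M] [AddCommGroup N] [Module R M] [Module R N]
    (f : M →ₗ[R] N) (hf : Function.Injective f) {J : Type*} (g : M →ₗ[R] (J → R)) :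
    ∃ h : N →ₗ[R] (J → R), ∀ x, h (f x) = g x := by
  choose h hh using fun j => hR.baer.extension_property f hf ((LinearMap.proj j).comp g)
  refine ⟨LinearMap.pi h, fun x => ?_⟩
  ext j
  exact LinearMap.congr_fun (hh j) x

theorem extend_one {M N : Type*} [AddCommGroup M] [AddCommGroup N] [Module R M] [Module R N]
    (f : M →ₗ[R] N) (hf : Function.Injective f) (g : M →ₗ[R] R) :
    ∃ h : N →ₗ[R] R, ∀ x, h (f x) = g x := by
  obtain ⟨h, hh⟩ := hR.baer.extension_property f hf g
  exact ⟨h, fun x => LinearMap.congr_fun hh x⟩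

end IsChainRing

/-! ### Finitely generated modules over chain rings -/

theorem LinearMap.exists_factor {R : Type*} [CommRing R] {U M N : Type*} [AddCommGroup U]
    [Module R U] [AddCommGroup M] [Module R M] [AddCommGroup N] [Module R N] (f : U →ₗ[R] M)
    (hf : Function.Surjective f) (g : U →ₗ[R] N) (h : ∀ x, f x = 0 → g x = 0) :
    ∃ l : M →ₗ[R] N, ∀ x, l (f x) = g x := by
  refine ⟨(LinearMap.ker f).liftQ g (fun x hx => h x hx) ∘ₗ
    (f.quotKerEquivOfSurjective hf).symm.toLinearMap, fun x => ?_⟩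
  have : (f.quotKerEquivOfSurjective hf).symm (f x) = (LinearMap.ker f).mkQ x := by
    rw [LinearEquiv.symm_apply_eq]; rfl
  rw [LinearMap.comp_apply, LinearEquiv.coe_coe, this]
  rfl

/-- `M` is the direct sum of the cyclic submodules generated by the `e j`, and the annihilator of
`e j` is generated by `ϖ ^ a j`. -/
structure IsCyclicBasis {R : Type u} [CommRing R] (ϖ : R) {M : Type v} [AddCommGroup M]
    [Module R M] {J : Type*} [Fintype J] (e : J → M) (a : J → ℕ) : Prop where
  pow_smul : ∀ j, ϖ ^ a j • e j = 0
  exists_sum : ∀ x : M, ∃ r : J → R, x = ∑ j, r j • e j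
  dvd_of_sum : ∀ r : J → R, ∑ j, r j • e j = 0 → ∀ j, ϖ ^ a j ∣ r j

theorem IsCyclicBasis.exists_linearMap {R : Type u} [CommRing R] {ϖ : R} {M : Type v}
    [AddCommGroup M] [Module R M] {J : Type*} [Fintype J] {e : J → M} {a : J → ℕ}
    (he : IsCyclicBasis ϖ e a) {N : Type*} [AddCommGroup N] [Module R N] (y : J → N)
    (hy : ∀ j, ϖ ^ a j • y j = 0) : ∃ h : M →ₗ[R] N, ∀ j, h (e j) = y j := by
  classical
  obtain ⟨h, hh⟩ := LinearMap.exists_factor (Fintype.linearCombination R e)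
    (fun x => by
      obtain ⟨r, hr⟩ := he.exists_sum x
      exact ⟨r, by rw [hr, Fintype.linearCombination_apply]⟩)
    (Fintype.linearCombination R y) (fun r hr => by
      rw [Fintype.linearCombination_apply] at hr ⊢
      refine Finset.sum_eq_zero fun j _ => ?_
      obtain ⟨t, ht⟩ := he.dvd_of_sum r hr j
      rw [ht, mul_comm, mul_smul, hy, smul_zero])
  refine ⟨h, fun j => ?_⟩
  simpa using hh (Pi.single j 1)

namespace IsChainRing

variable {R : Type u} [CommRing R] [IsLocalRing R] {k : Type w} [Field k]
  {ϖ : R} {n : ℕ} {ρ : R →+* k} (hR : IsChainRing R ϖ n ρ)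

include hR

theorem dvd_of_smul_eq_zero {M : Type*} [AddCommGroup M] [Module R M] {x : M} {a : ℕ}
    (hx : ϖ ^ (a - 1) • x ≠ 0) {r : R} (hr : r • x = 0) : ϖ ^ a ∣ r := by
  by_cases h0 : r = 0
  · simp [h0]
  obtain ⟨c, -, s, hs, rfl⟩ := hR.exists_unit_mul_pow r h0
  refine Dvd.dvd.mul_left (pow_dvd_pow _ ?_) _
  by_contra hlt
  apply hx
  rw [mul_smul] at hr
  have h1 : ϖ ^ c • x = 0 := by
    obtain ⟨s, rfl⟩ := hs
    rwa [← Units.smul_def, smul_eq_zero_iff_eq] at hr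
  have h2 : a - 1 = (a - 1 - c) + c := by omega
  rw [h2, pow_add, mul_smul, h1, smul_zero]

/-- Cancelling `ϖ^b` costs an error in `(ϖ^(n-b))`, which is harmless because `a ≤ n`. -/
theorem pow_dvd_of_dvd_mul {a b : ℕ} (ha : a ≤ n) {r : R} (h : ϖ ^ a ∣ ϖ ^ b * r) :
    ϖ ^ (a - b) ∣ r := by
  rcases le_total a b with hab | hab
  · simp [Nat.sub_eq_zero_of_le hab]
  obtain ⟨t, ht⟩ := h
  have h1 : ϖ ^ b * (r - ϖ ^ (a - b) * t) = 0 := by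
    rw [mul_sub, ht, ← mul_assoc, ← pow_add, Nat.add_sub_cancel' hab, sub_self]
  have h2 : ϖ ^ (a - b) ∣ r - ϖ ^ (a - b) * t :=
    (pow_dvd_pow _ (by omega)).trans (hR.dvd_of_pow_mul_eq_zero h1)
  exact (dvd_sub_left (dvd_mul_right _ _)).1 h2

/-- An element of maximal order generates a direct summand. The embedding `R/𝔪^a → R`, `1 ↦
ϖ^(n-a)`, extends along `1 ↦ x` to a functional on `M` by self-injectivity. Since `ϖ^a` kills `M`,
its values lie in `(ϖ^(n-a))`, so its kernel is a complement of `Rx`. -/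
theorem exists_split {M : Type*} [AddCommGroup M] [Module R M] {a : ℕ} (han : a ≤ n)
    (ha : ∀ y : M, ϖ ^ a • y = 0) {x : M} (hx : ϖ ^ (a - 1) • x ≠ 0) :
    ∃ K : Submodule R M, x ∉ K ∧
      Nonempty (((R ⧸ IsLocalRing.maximalIdeal R ^ a) × K) ≃ₗ[R] M) := by
  let I := IsLocalRing.maximalIdeal R ^ a
  let j : (R ⧸ I) →ₗ[R] M := I.liftQ (LinearMap.toSpanSingleton R M x) (fun r hr => by
    obtain ⟨t, rfl⟩ := hR.mem_max_pow.1 hr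
    rw [LinearMap.mem_ker, LinearMap.toSpanSingleton_apply, mul_comm, mul_smul, ha, smul_zero])
  have hj : ∀ r : R, j (I.mkQ r) = r • x := fun r => rfl
  let g : (R ⧸ I) →ₗ[R] R := I.liftQ (LinearMap.toSpanSingleton R R (ϖ ^ (n - a))) (fun r hr => by
    obtain ⟨t, rfl⟩ := hR.mem_max_pow.1 hr
    rw [LinearMap.mem_ker, LinearMap.toSpanSingleton_apply, smul_eq_mul, mul_right_comm, ← pow_add,
      hR.pow_eq_zero_of_le (by omega), zero_mul])
  have hg : ∀ r : R, g (I.mkQ r) = r * ϖ ^ (n - a) := fun r => rfl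
  have hj0 : Function.Injective j := by
    rw [injective_iff_map_eq_zero]
    intro q hq
    obtain ⟨r, rfl⟩ := I.mkQ_surjective q
    rw [hj] at hq
    exact (Submodule.Quotient.mk_eq_zero _).2 (hR.mem_max_pow.2 (hR.dvd_of_smul_eq_zero hx hq))
  obtain ⟨f, hf⟩ := hR.extend_one j hj0 g
  have hfx : ∀ r : R, f (r • x) = r * ϖ ^ (n - a) := fun r => by rw [← hj, hf, hg]
  have ha1 : 1 ≤ a := by
    by_contra hlt
    have : a = 0 := by omega
    subst this
    exact hx (ha x)
  refine ⟨LinearMap.ker f, ?_, ⟨LinearEquiv.ofBijective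
    (LinearMap.coprod j (LinearMap.ker f).subtype) ⟨?_, ?_⟩⟩⟩
  · intro h
    have h1 := hfx 1
    rw [one_smul, LinearMap.mem_ker.1 h, one_mul] at h1
    exact hR.pow_ne_zero_of_lt (show n - a < n by omega) h1.symm
  · rw [injective_iff_map_eq_zero]
    rintro ⟨q, z⟩ hq
    obtain ⟨r, rfl⟩ := I.mkQ_surjective q
    simp only [LinearMap.coprod_apply, hj, Submodule.coe_subtype] at hq
    have h1 : r * ϖ ^ (n - a) = 0 := by
      have := congrArg f hq
      rwa [map_add, hfx, LinearMap.mem_ker.1 z.2, add_zero, map_zero] at this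
    have h2 : ϖ ^ a ∣ r := by
      have := hR.dvd_of_pow_mul_eq_zero (a := n - a) (r := r) (by rw [mul_comm]; exact h1)
      rwa [Nat.sub_sub_self han] at this
    have h3 : I.mkQ r = 0 := (Submodule.Quotient.mk_eq_zero _).2 (hR.mem_max_pow.2 h2)
    have h4 : r • x = 0 := by rw [← hj, h3, map_zero]
    rw [h4, zero_add] at hq
    rw [h3]
    exact Prod.ext rfl (Subtype.ext hq)
  · intro y
    have h1 : ϖ ^ a * f y = 0 := by
      rw [← smul_eq_mul, ← map_smul, ha, map_zero]
    obtain ⟨c, hc⟩ := hR.dvd_of_pow_mul_eq_zero h1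
    refine ⟨(I.mkQ c, ⟨y - c • x, ?_⟩), ?_⟩
    · rw [LinearMap.mem_ker, map_sub, hfx, hc]; ring
    · simp only [LinearMap.coprod_apply, hj, Submodule.coe_subtype, add_sub_cancel]

/-- The bound `b` keeps the list sorted: the summand split off has the largest exponent `a`
occurring, and its complement, of smaller length, is treated with `a` as the new bound. -/
theorem exists_partition_aux (l : ℕ) : ∀ (M : Type v) [AddCommGroup M] [Module R M]
    [Module.Finite R M] (b : ℕ), b ≤ n → (∀ x : M, ϖ ^ b • x = 0) → Module.length R M ≤ l →
    ∃ α : List ℕ, α.Pairwise (· ≥ ·) ∧ (∀ a ∈ α, 1 ≤ a ∧ a ≤ b) ∧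
      Nonempty (M ≃ₗ[R] ∀ i : Fin α.length, R ⧸ IsLocalRing.maximalIdeal R ^ α.get i) := by
  have := hR.noeth
  have := hR.artin
  induction l with
  | zero =>
    intro M _ _ _ b _ _ hl
    have hM : Subsingleton M :=
      (Module.length_eq_zero_iff (R := R)).1 (nonpos_iff_eq_zero.1 (by simpa using hl))
    refine ⟨[], List.Pairwise.nil, by simp, ⟨?_⟩⟩
    have : Subsingleton
        (∀ i : Fin ([] : List ℕ).length, R ⧸ IsLocalRing.maximalIdeal R ^ ([] : List ℕ).get i) :=
      ⟨fun f g => funext fun i => i.elim0⟩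
    exact ⟨0, 0, fun _ => Subsingleton.elim _ _, fun _ => Subsingleton.elim _ _⟩
  | succ l ih =>
    intro M _ _ _ b hbn hb hl
    classical
    have hex : ∃ a, ∀ x : M, ϖ ^ a • x = 0 := ⟨b, hb⟩
    set a := Nat.find hex with ha_def
    have ha : ∀ x : M, ϖ ^ a • x = 0 := Nat.find_spec hex
    have hab : a ≤ b := Nat.find_min' hex hb
    rcases Nat.eq_zero_or_pos a with h0 | hpos
    · have hM : Subsingleton M := subsingleton_of_forall_eq 0 fun x => by
        have := ha x
        rwa [h0, pow_zero, one_smul] at this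
      exact ih M b hbn hb (by rw [Module.length_eq_zero]; exact zero_le)
    · have h1 := Nat.find_min hex (show a - 1 < a by omega)
      push Not at h1
      obtain ⟨x, hx⟩ := h1
      obtain ⟨K, hxK, ⟨e⟩⟩ := hR.exists_split (hab.trans hbn) ha hx
      have hlt : Module.length R K < Module.length R M :=
        Submodule.length_lt fun h => hxK (h ▸ Submodule.mem_top)
      have hK : Module.length R K ≤ l := by
        have h2 : Module.length R K < ((l + 1 : ℕ) : ℕ∞) := hlt.trans_le hl
        exact ENat.lt_natCast_add_one_iff.1 (by exact_mod_cast h2)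
      obtain ⟨α, hα1, hα2, ⟨f⟩⟩ := ih K a (hab.trans hbn)
        (fun y => Subtype.ext (ha y)) hK
      refine ⟨a :: α, List.pairwise_cons.2 ⟨fun c hc => (hα2 c hc).2, hα1⟩, ?_, ⟨?_⟩⟩
      · intro c hc
        rcases List.mem_cons.1 hc with rfl | hc
        · exact ⟨hpos, hab⟩
        · exact ⟨(hα2 c hc).1, (hα2 c hc).2.trans hab⟩
      · exact e.symm.trans (((LinearEquiv.refl R _).prodCongr f).trans
          (Fin.consLinearEquiv R (fun i : Fin (α.length + 1) =>
            R ⧸ IsLocalRing.maximalIdeal R ^ (a :: α).get i)))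

theorem exists_hasPartition (M : Type v) [AddCommGroup M] [Module R M] [Module.Finite R M] :
    ∃ α, HasPartition R M α := by
  have := hR.noeth
  have := hR.artin
  obtain ⟨l, hl⟩ := ENat.ne_top_iff_exists.1 (Module.length_ne_top (R := R) (M := M))
  obtain ⟨α, h1, h2, h3⟩ := hR.exists_partition_aux l M n le_rfl
    (fun x => by rw [hR.pow_eq, zero_smul]) hl.ge
  exact ⟨α, h1, by rwa [hR.loewy], h3⟩

theorem exists_isCyclicBasis_of_hasPartition {M : Type v} [AddCommGroup M] [Module R M]
    {α : List ℕ} (hα : HasPartition R M α) :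
    ∃ e : Fin α.length → M, IsCyclicBasis ϖ e α.get ∧ ∀ j, 1 ≤ α.get j ∧ α.get j ≤ n := by
  classical
  obtain ⟨h1, h2, ⟨f⟩⟩ := hα
  rw [hR.loewy] at h2
  refine ⟨fun j => f.symm (Pi.single j (Ideal.Quotient.mk _ 1)),
    ⟨fun j => ?_, fun x => ?_, fun r hr j => ?_⟩, fun j => h2 _ (List.get_mem α j)⟩
  · rw [← map_smul, ← Pi.single_smul]
    have : ϖ ^ α.get j • (Ideal.Quotient.mk (IsLocalRing.maximalIdeal R ^ α.get j) 1) = 0 := by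
      rw [← Ideal.Quotient.mk_eq_mk, ← Submodule.Quotient.mk_smul, Submodule.Quotient.mk_eq_zero,
        hR.mem_max_pow]
      simp
    rw [this, Pi.single_zero, map_zero]
  · choose r hr using fun j => Ideal.Quotient.mk_surjective (f x j)
    refine ⟨r, ?_⟩
    simp_rw [← map_smul]
    rw [← map_sum, LinearEquiv.eq_symm_apply]
    ext j
    simp_rw [← Pi.single_smul]
    rw [Finset.sum_apply, Finset.sum_eq_single j]
    · rw [Pi.single_eq_same, ← hr, ← Ideal.Quotient.mk_eq_mk, ← Ideal.Quotient.mk_eq_mk,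
        ← Submodule.Quotient.mk_smul, smul_eq_mul, mul_one]
    · intro i _ hij
      rw [Pi.single_eq_of_ne hij.symm]
    · simp
  · simp_rw [← map_smul] at hr
    rw [← map_sum, map_eq_zero_iff _ f.symm.injective] at hr
    have h := congrFun hr j
    simp_rw [← Pi.single_smul] at h
    rw [Finset.sum_apply, Finset.sum_eq_single j, Pi.single_eq_same, ← Ideal.Quotient.mk_eq_mk,
        ← Submodule.Quotient.mk_smul, smul_eq_mul, mul_one, Pi.zero_apply,
        Submodule.Quotient.mk_eq_zero, hR.mem_max_pow] at h
    · exact h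
    · intro i _ hij
      rw [Pi.single_eq_of_ne hij.symm]
    · simp

theorem exists_isCyclicBasis (M : Type v) [AddCommGroup M] [Module R M] [Module.Finite R M] :
    ∃ (m : ℕ) (e : Fin m → M) (a : Fin m → ℕ), IsCyclicBasis ϖ e a ∧ ∀ j, 1 ≤ a j ∧ a j ≤ n := by
  obtain ⟨α, hα⟩ := hR.exists_hasPartition M
  obtain ⟨e, he⟩ := hR.exists_isCyclicBasis_of_hasPartition hα
  exact ⟨_, e, _, he⟩

theorem coeff_dvd {M : Type*} [AddCommGroup M] [Module R M] {J : Type*} [Fintype J] {e : J → M}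
    {a : J → ℕ} (he : IsCyclicBasis ϖ e a) (ha : ∀ j, a j ≤ n) {b : ℕ} {r : J → R}
    (h : ϖ ^ b • ∑ j, r j • e j = 0) (j : J) : ϖ ^ (a j - b) ∣ r j := by
  rw [Finset.smul_sum] at h
  simp_rw [← mul_smul] at h
  exact hR.pow_dvd_of_dvd_mul (ha j) (he.dvd_of_sum _ h j)

end IsChainRing

/-! ### Subquotients killed by the maximal ideal -/

section Subquotient

variable {R : Type u} [CommRing R] {k : Type w} [Field k] (ρ : R →+* k)
  {M : Type*} [AddCommGroup M] [Module R M]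

/-- The function `f` is `ρ`-semilinear on the submodule `V`. -/
structure IsSemilinearOn {A : Type*} [AddCommGroup A] [Module k A] (V : Submodule R M)
    (f : M → A) : Prop where
  add : ∀ x ∈ V, ∀ y ∈ V, f (x + y) = f x + f y
  smul : ∀ (r : R), ∀ x ∈ V, f (r • x) = ρ r • f x

/-- The function `f` identifies the subquotient `V / W` of `M` with the `k`-vector space `A`. -/
structure IsSubquotientMap {A : Type*} [AddCommGroup A] [Module k A] (V W : Submodule R M)
    (f : M → A) : Prop extends IsSemilinearOn ρ V f where
  surj : ∀ a, ∃ x ∈ V, f x = a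
  ker : ∀ x ∈ V, f x = 0 ↔ x ∈ W

variable {ρ} {A : Type*} [AddCommGroup A] [Module k A] {V W : Submodule R M} {f : M → A}

namespace IsSemilinearOn

variable (hf : IsSemilinearOn ρ V f)
include hf

theorem map_zero : f 0 = 0 := by
  have := hf.smul 0 0 V.zero_mem
  rwa [smul_zero, _root_.map_zero, zero_smul] at this

theorem map_sub {x y : M} (hx : x ∈ V) (hy : y ∈ V) : f (x - y) = f x - f y := by
  have h := hf.smul (-1) y hy
  rw [map_neg, map_one, neg_smul, neg_smul, one_smul, one_smul] at h
  rw [sub_eq_add_neg, hf.add x hx _ (V.neg_mem hy), h, sub_eq_add_neg]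

theorem map_sum {J : Type*} (s : Finset J) {x : J → M} (hx : ∀ j ∈ s, x j ∈ V) :
    f (∑ j ∈ s, x j) = ∑ j ∈ s, f (x j) := by
  classical
  induction s using Finset.induction_on with
  | empty => simpa using hf.map_zero
  | insert a s ha ih =>
    rw [Finset.sum_insert ha, Finset.sum_insert ha,
      hf.add _ (hx a (Finset.mem_insert_self a s)) _
        (V.sum_mem fun j hj => hx j (Finset.mem_insert_of_mem hj)),
      ih fun j hj => hx j (Finset.mem_insert_of_mem hj)]

theorem comp {N : Type*} [AddCommGroup N] [Module R N] {U : Submodule R N} (h : N →ₗ[R] M)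
    (hU : ∀ x ∈ U, h x ∈ V) : IsSemilinearOn ρ U (fun x => f (h x)) where
  add x hx y hy := by rw [_root_.map_add, hf.add _ (hU x hx) _ (hU y hy)]
  smul r x hx := by rw [_root_.map_smul, hf.smul _ _ (hU x hx)]

theorem linear_comp {B : Type*} [AddCommGroup B] [Module k B] (l : A →ₗ[k] B) :
    IsSemilinearOn ρ V (fun x => l (f x)) where
  add x hx y hy := by rw [hf.add x hx y hy, _root_.map_add]
  smul r x hx := by rw [hf.smul r x hx, _root_.map_smul]

theorem mono {U : Submodule R M} (hU : U ≤ V) : IsSemilinearOn ρ U f where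
  add x hx y hy := hf.add x (hU hx) y (hU hy)
  smul r x hx := hf.smul r x (hU hx)

end IsSemilinearOn

theorem IsSubquotientMap.exists_factor (hρ : Function.Surjective ρ)
    (hf : IsSubquotientMap ρ V W f) {B : Type*} [AddCommGroup B] [Module k B] {g : M → B}
    (hg : IsSemilinearOn ρ V g) (hW : ∀ x ∈ V, x ∈ W → g x = 0) :
    ∃ l : A →ₗ[k] B, ∀ x ∈ V, l (f x) = g x := by
  choose s hsV hs using hf.surj
  have key : ∀ x ∈ V, g (s (f x)) = g x := fun x hx => by
    have h1 : f (s (f x) - x) = 0 := by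
      rw [hf.map_sub (hsV _) hx, hs, sub_self]
    have h2 := hW _ (V.sub_mem (hsV _) hx) ((hf.ker _ (V.sub_mem (hsV _) hx)).1 h1)
    rwa [hg.map_sub (hsV _) hx, sub_eq_zero] at h2
  refine ⟨⟨⟨fun a => g (s a), fun a b => ?_⟩, fun c a => ?_⟩, key⟩
  · have := key (s a + s b) (V.add_mem (hsV a) (hsV b))
    rwa [hf.add _ (hsV a) _ (hsV b), hs, hs, hg.add _ (hsV a) _ (hsV b)] at this
  · obtain ⟨r, rfl⟩ := hρ c
    have := key (r • s a) (V.smul_mem r (hsV a))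
    rwa [hf.smul _ _ (hsV a), hs, hg.smul _ _ (hsV a)] at this

theorem IsSubquotientMap.comp_equiv (hf : IsSubquotientMap ρ V W f)
    {B : Type*} [AddCommGroup B] [Module k B] (l : A ≃ₗ[k] B) :
    IsSubquotientMap ρ V W (fun x => l (f x)) where
  toIsSemilinearOn := hf.toIsSemilinearOn.linear_comp l.toLinearMap
  surj b := by
    obtain ⟨x, hx, h⟩ := hf.surj (l.symm b)
    exact ⟨x, hx, by rw [h, LinearEquiv.apply_symm_apply]⟩
  ker x hx := by rw [LinearEquiv.map_eq_zero_iff]; exact hf.ker x hx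

theorem IsSubquotientMap.comp_linearEquiv (hf : IsSubquotientMap ρ V W f)
    {N : Type*} [AddCommGroup N] [Module R N] {V' W' : Submodule R N} (h : N ≃ₗ[R] M)
    (hV : ∀ x, x ∈ V' ↔ h x ∈ V) (hW : ∀ x, x ∈ W' ↔ h x ∈ W) :
    IsSubquotientMap ρ V' W' (fun x => f (h x)) where
  toIsSemilinearOn := hf.toIsSemilinearOn.comp h.toLinearMap fun x hx => (hV x).1 hx
  surj b := by
    obtain ⟨x, hx, h'⟩ := hf.surj b
    exact ⟨h.symm x, by rwa [hV, LinearEquiv.apply_symm_apply],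
      by rwa [LinearEquiv.apply_symm_apply]⟩
  ker x hx := by rw [hf.ker _ ((hV x).1 hx), hW]

theorem IsSubquotientMap.prod (hf : IsSubquotientMap ρ V W f)
    {N : Type*} [AddCommGroup N] [Module R N] {V' W' : Submodule R N}
    {B : Type*} [AddCommGroup B] [Module k B] {g : N → B} (hg : IsSubquotientMap ρ V' W' g) :
    IsSubquotientMap ρ (V.prod V') (W.prod W') (fun x : M × N => (f x.1, g x.2)) where
  add x hx y hy := Prod.ext (hf.add _ hx.1 _ hy.1) (hg.add _ hx.2 _ hy.2)
  smul r x hx := Prod.ext (hf.smul _ _ hx.1) (hg.smul _ _ hx.2)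
  surj b := by
    obtain ⟨x, hx, h⟩ := hf.surj b.1
    obtain ⟨y, hy, h'⟩ := hg.surj b.2
    exact ⟨(x, y), ⟨hx, hy⟩, Prod.ext h h'⟩
  ker x hx := by
    rw [Prod.mk_eq_zero, hf.ker _ hx.1, hg.ker _ hx.2]; rfl

/-- The way subquotients are computed below: `T` parametrizes `V`, and `g` has kernel `T⁻¹(W)`, so
`T y ↦ g y` is well defined. Outside `V` the value is irrelevant and is set to `0`. -/
theorem exists_isSubquotientMap_of_param {U : Type*} [AddCommGroup U] [Module R U]
    (T : U →ₗ[R] M) (g : U →ₛₗ[ρ] A) (hg : Function.Surjective g)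
    (hV : ∀ x, x ∈ V ↔ ∃ y, T y = x) (hW : ∀ y, T y ∈ W ↔ g y = 0) :
    ∃ f : M → A, IsSubquotientMap ρ V W f ∧ ∀ y, f (T y) = g y := by
  classical
  have h0 : ∀ y z, T y = T z → g y = g z := fun y z h => by
    rw [← sub_eq_zero, ← map_sub, ← hW, map_sub, h, sub_self]
    exact W.zero_mem
  let f : M → A := fun x => if h : ∃ y, T y = x then g h.choose else 0
  have hf : ∀ y, f (T y) = g y := fun y => by
    have h : ∃ z, T z = T y := ⟨y, rfl⟩
    simp only [f, dif_pos h]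
    exact h0 _ _ h.choose_spec
  refine ⟨f, ⟨⟨?_, ?_⟩, ?_, ?_⟩, hf⟩
  · intro x hx y hy
    obtain ⟨a, rfl⟩ := (hV x).1 hx
    obtain ⟨b, rfl⟩ := (hV y).1 hy
    rw [← map_add, hf, hf, hf, map_add]
  · intro r x hx
    obtain ⟨a, rfl⟩ := (hV x).1 hx
    rw [← map_smul, hf, hf, map_smulₛₗ]
  · intro a
    obtain ⟨y, rfl⟩ := hg a
    exact ⟨T y, (hV _).2 ⟨y, rfl⟩, hf y⟩
  · intro x hx
    obtain ⟨a, rfl⟩ := (hV x).1 hx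
    rw [hf, hW]

end Subquotient

/-! ### Torsion submodules and submodules of multiples -/

section Torsion

variable {R : Type u} [CommRing R] (ϖ : R) (a : ℕ) (M : Type*) [AddCommGroup M] [Module R M]

/-- The submodule of elements killed by `ϖ ^ a`. -/
def powTorsion : Submodule R M := LinearMap.ker (LinearMap.lsmul R M (ϖ ^ a))

/-- The submodule of multiples of `ϖ ^ a`. -/
def powMultiples : Submodule R M := LinearMap.range (LinearMap.lsmul R M (ϖ ^ a))

variable {ϖ a M}

theorem mem_powTorsion {x : M} : x ∈ powTorsion ϖ a M ↔ ϖ ^ a • x = 0 := Iff.rfl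

theorem mem_powMultiples {x : M} : x ∈ powMultiples ϖ a M ↔ ∃ z, ϖ ^ a • z = x := Iff.rfl

theorem map_mem_powTorsion {N : Type*} [AddCommGroup N] [Module R N] (h : M →ₗ[R] N) {x : M}
    (hx : x ∈ powTorsion ϖ a M) : h x ∈ powTorsion ϖ a N := by
  rw [mem_powTorsion] at *
  rw [← map_smul, hx, map_zero]

theorem map_mem_powMultiples {N : Type*} [AddCommGroup N] [Module R N] (h : M →ₗ[R] N) {x : M}
    (hx : x ∈ powMultiples ϖ a M) : h x ∈ powMultiples ϖ a N := by
  obtain ⟨z, rfl⟩ := mem_powMultiples.1 hx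
  exact ⟨h z, by simp⟩

theorem powTorsion_mono {b : ℕ} (h : a ≤ b) : powTorsion ϖ a M ≤ powTorsion ϖ b M := by
  intro x hx
  rw [mem_powTorsion] at *
  rw [← Nat.sub_add_cancel h, pow_add, mul_smul, hx, smul_zero]

theorem powMultiples_anti {b : ℕ} (h : a ≤ b) : powMultiples ϖ b M ≤ powMultiples ϖ a M := by
  rintro x ⟨z, rfl⟩
  refine ⟨ϖ ^ (b - a) • z, ?_⟩
  simp only [LinearMap.lsmul_apply]
  rw [← mul_smul, ← pow_add, Nat.add_sub_cancel' h]

end Torsion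

namespace IsChainRing

variable {R : Type u} [CommRing R] [IsLocalRing R] {k : Type w} [Field k]
  {ϖ : R} {n : ℕ} {ρ : R →+* k} (hR : IsChainRing R ϖ n ρ)

include hR

/-- As `ϖ` kills `V/W`, all exponents of a cyclic basis of `V/W` equal `1`, and the residues of the
coordinates are well defined. -/
theorem exists_isSubquotientMap {M : Type*} [AddCommGroup M] [Module R M] [Module.Finite R M]
    (V W : Submodule R M) (h : ∀ x ∈ V, ϖ • x ∈ W) :
    ∃ (d : ℕ) (f : M → (Fin d → k)), IsSubquotientMap ρ V W f := by
  classical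
  have := hR.noeth
  obtain ⟨m, e, a, he, ha⟩ := hR.exists_isCyclicBasis (V ⧸ W.comap V.subtype)
  have hk : ∀ q : V ⧸ W.comap V.subtype, ϖ • q = 0 := fun q => by
    obtain ⟨x, rfl⟩ := Submodule.mkQ_surjective _ q
    rw [← map_smul, Submodule.mkQ_apply, Submodule.Quotient.mk_eq_zero]
    exact h x x.2
  have ha1 : ∀ j, a j = 1 := fun j => by
    have h1 : ϖ ^ a j ∣ ϖ ^ 1 * 1 := by
      have := he.dvd_of_sum (fun i => if i = j then ϖ else 0) (by simp [hk]) j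
      simpa using this
    have h2 := hR.pow_dvd_of_dvd_mul (ha j).2 h1
    have h3 := (ha j).1
    by_contra hne
    have h4 : ϖ ∣ 1 := (dvd_pow_self ϖ (show a j - 1 ≠ 0 by omega)).trans h2
    exact one_ne_zero ((map_one ρ).symm.trans ((hR.rho_eq_zero 1).2 h4))
  refine ⟨m, ?_⟩
  let T : (Fin m → R) →ₗ[R] (V ⧸ W.comap V.subtype) := Fintype.linearCombination R e
  have hT : ∀ r, T r = 0 ↔ ∀ j, ρ (r j) = 0 := fun r => by
    constructor
    · intro hr j
      have := he.dvd_of_sum r (by simpa [T, Fintype.linearCombination_apply] using hr) j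
      rwa [ha1, pow_one, ← hR.rho_eq_zero] at this
    · intro hr
      simp only [T, Fintype.linearCombination_apply]
      refine Finset.sum_eq_zero fun j _ => ?_
      obtain ⟨t, ht⟩ := (hR.rho_eq_zero _).1 (hr j)
      rw [ht, mul_smul, hk]
  have hTs : Function.Surjective T := fun q => by
    obtain ⟨r, hr⟩ := he.exists_sum q
    exact ⟨r, by rw [hr]; simp [T, Fintype.linearCombination_apply]⟩
  choose c hc using hTs
  let f : M → (Fin m → k) := fun x =>
    if hx : x ∈ V then fun j => ρ (c ((W.comap V.subtype).mkQ ⟨x, hx⟩) j) else 0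
  have hf : ∀ (x : M) (hx : x ∈ V) (r : Fin m → R), T r = (W.comap V.subtype).mkQ ⟨x, hx⟩ →
      f x = fun j => ρ (r j) := fun x hx r hr => by
    simp only [f, dif_pos hx]
    funext j
    have := (hT (c ((W.comap V.subtype).mkQ ⟨x, hx⟩) - r)).1 (by rw [map_sub, hc, hr, sub_self]) j
    rwa [Pi.sub_apply, map_sub, sub_eq_zero] at this
  have hex : ∀ (x : M) (hx : x ∈ V), ∃ r, T r = (W.comap V.subtype).mkQ ⟨x, hx⟩ :=
    fun x hx => ⟨_, hc _⟩
  refine ⟨f, ⟨⟨?_, ?_⟩, ?_, ?_⟩⟩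
  · intro x hx y hy
    obtain ⟨r, hr⟩ := hex x hx
    obtain ⟨s, hs⟩ := hex y hy
    rw [hf x hx r hr, hf y hy s hs, hf (x + y) (V.add_mem hx hy) (r + s)
      (by rw [map_add, hr, hs, ← map_add]; rfl)]
    funext j
    simp
  · intro t x hx
    obtain ⟨r, hr⟩ := hex x hx
    rw [hf x hx r hr, hf (t • x) (V.smul_mem t hx) (t • r) (by rw [map_smul, hr, ← map_smul]; rfl)]
    funext j
    simp
  · intro b
    choose r hr using fun j => hR.surj (b j)
    obtain ⟨x, hx⟩ := Submodule.mkQ_surjective _ (T r)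
    exact ⟨x, x.2, by rw [hf x x.2 r hx.symm]; exact funext hr⟩
  · intro x hx
    obtain ⟨r, hr⟩ := hex x hx
    rw [hf x hx r hr, show (x ∈ W ↔ (W.comap V.subtype).mkQ ⟨x, hx⟩ = 0) by
      rw [Submodule.mkQ_apply, Submodule.Quotient.mk_eq_zero]; rfl, ← hr, hT]
    exact funext_iff

end IsChainRing

/-! ### Stable invariants of modules -/

/-- Pairs of vector spaces with maps in both directions; these record the objects of the stable
module category. -/
structure StableObj (k : Type w) [Field k] where
  A : Type v
  B : Type v
  [addCommGroupA : AddCommGroup A]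
  [addCommGroupB : AddCommGroup B]
  [moduleA : Module k A]
  [moduleB : Module k B]
  ι : A →ₗ[k] B
  p : B →ₗ[k] A

attribute [instance] StableObj.addCommGroupA StableObj.addCommGroupB StableObj.moduleA
  StableObj.moduleB

/-- An identification of the stable invariants of the module `M` with `X`. -/
structure Marking {R : Type u} [CommRing R] {k : Type w} [Field k] (ϖ : R) (n : ℕ) (ρ : R →+* k)
    (M : Type*) [AddCommGroup M] [Module R M] (X : StableObj k) where
  α : M → X.A
  β : M → X.B
  hα : IsSubquotientMap ρ (powTorsion ϖ 1 M) (powMultiples ϖ (n - 1) M) α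
  hβ : IsSubquotientMap ρ (powTorsion ϖ 2 M) (powMultiples ϖ (n - 2) M) β
  ι_α : ∀ x ∈ powTorsion ϖ 1 M, X.ι (α x) = β x
  p_β : ∀ x ∈ powTorsion ϖ 2 M, X.p (β x) = α (ϖ • x)

/-- The map `h` vanishes on the stable invariants. -/
def StablyZero {R : Type u} [CommRing R] (ϖ : R) (n : ℕ) {M N : Type*} [AddCommGroup M]
    [Module R M] [AddCommGroup N] [Module R N] (h : M →ₗ[R] N) : Prop :=
  (∀ x ∈ powTorsion ϖ 1 M, h x ∈ powMultiples ϖ (n - 1) N) ∧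
    ∀ x ∈ powTorsion ϖ 2 M, h x ∈ powMultiples ϖ (n - 2) N

namespace IsChainRing

variable {R : Type u} [CommRing R] [IsLocalRing R] {k : Type w} [Field k]
  {ϖ : R} {n : ℕ} {ρ : R →+* k} (hR : IsChainRing R ϖ n ρ)

include hR

/-- Maps through a free module vanish stably, because the `ϖ^a`-torsion of `R` is contained in
`(ϖ^(n-a))`. -/
theorem comp_mem_powMultiples {M N J : Type*} [AddCommGroup M] [Module R M] [AddCommGroup N]
    [Module R N] [Fintype J] (b : M →ₗ[R] (J → R)) (z : J → N) {a : ℕ} {x : M}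
    (hx : x ∈ powTorsion ϖ a M) : ∑ j, b x j • z j ∈ powMultiples ϖ (n - a) N := by
  refine Submodule.sum_mem _ fun j _ => ?_
  have h : ϖ ^ a * b x j = 0 := by
    rw [← smul_eq_mul, ← Pi.smul_apply, ← map_smul, mem_powTorsion.1 hx, map_zero, Pi.zero_apply]
  obtain ⟨t, ht⟩ := hR.dvd_of_pow_mul_eq_zero h
  exact ⟨t • z j, by rw [ht, mul_smul]; rfl⟩

/-- A stably zero map sends a generator of exponent `a` into `ϖ^(n-a) N`, so it factors through the
free module on the generators via `e j ↦ ϖ^(n - a j)`. The first factor extends to `M` by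
injectivity of free modules. -/
theorem exists_extension_of_stablyZero (hn : n ≤ 3) {P M N : Type*} [AddCommGroup P] [Module R P]
    [Module.Finite R P] [AddCommGroup M] [Module R M] [AddCommGroup N] [Module R N]
    (i : P →ₗ[R] M) (hi : Function.Injective i) (h : P →ₗ[R] N) (hh : StablyZero ϖ n h) :
    ∃ u : M →ₗ[R] N, (∀ x, u (i x) = h x) ∧ StablyZero ϖ n u := by
  classical
  obtain ⟨m, e, a, he, ha⟩ := hR.exists_isCyclicBasis P
  have hz : ∀ j, ∃ z, ϖ ^ (n - a j) • z = h (e j) := fun j => by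
    obtain ⟨h1, h2⟩ := ha j
    have h3 := he.pow_smul j
    -- This is where `n ≤ 3` enters: exponents `1` and `2` are controlled by the two halves of
    -- `StablyZero`, and exponent `n` needs no condition.
    obtain h4 | h4 | h4 : a j = 1 ∨ a j = 2 ∨ a j = n := by omega
    · rw [h4] at h3 ⊢; exact hh.1 _ h3
    · rw [h4] at h3 ⊢; exact hh.2 _ h3
    · rw [h4]; exact ⟨h (e j), by simp⟩
  choose z hz using hz
  obtain ⟨b, hb⟩ := he.exists_linearMap (fun j => (Pi.single j (ϖ ^ (n - a j)) : Fin m → R))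
    (fun j => by
      rw [← Pi.single_smul, smul_eq_mul, ← pow_add,
        hR.pow_eq_zero_of_le (by have := (ha j).2; omega), Pi.single_zero])
  obtain ⟨b', hb'⟩ := hR.extend i hi b
  refine ⟨Fintype.linearCombination R z ∘ₗ b', fun x => ?_, fun x hx => ?_, fun x hx => ?_⟩
  · obtain ⟨r, rfl⟩ := he.exists_sum x
    rw [LinearMap.comp_apply, hb', map_sum, map_sum, map_sum]
    refine Finset.sum_congr rfl fun j _ => ?_
    rw [map_smul, map_smul, map_smul, hb, Fintype.linearCombination_apply_single, hz]
  · rw [LinearMap.comp_apply, Fintype.linearCombination_apply]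
    exact hR.comp_mem_powMultiples b' z hx
  · rw [LinearMap.comp_apply, Fintype.linearCombination_apply]
    exact hR.comp_mem_powMultiples b' z hx

/-- Fullness of the stable invariants. A generator of exponent `1` or `2` is sent to a
representative of the prescribed class in `A` or `B`. Compatibility with `p` and `ι` then gives the
right value on the other space. -/
theorem exists_lift (hn : n ≤ 3) {M N : Type*} [AddCommGroup M] [Module R M]
    [Module.Finite R M] [AddCommGroup N] [Module R N] {X : StableObj k}
    {Y : StableObj k} (μ : Marking ϖ n ρ M X) (ν : Marking ϖ n ρ N Y)
    (φA : X.A →ₗ[k] Y.A) (φB : X.B →ₗ[k] Y.B) (hι : ∀ a, φB (X.ι a) = Y.ι (φA a))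
    (hp : ∀ b, φA (X.p b) = Y.p (φB b)) :
    ∃ h : M →ₗ[R] N, (∀ x ∈ powTorsion ϖ 1 M, ν.α (h x) = φA (μ.α x)) ∧
      ∀ x ∈ powTorsion ϖ 2 M, ν.β (h x) = φB (μ.β x) := by
  obtain ⟨m, e, a, he, ha⟩ := hR.exists_isCyclicBasis M
  have hy : ∀ j, ∃ y : N, ϖ ^ a j • y = 0 ∧ (a j = 1 → ν.α y = φA (μ.α (e j))) ∧
      (a j = 2 → ν.β y = φB (μ.β (e j))) := fun j => by
    obtain ⟨h1, h2⟩ := ha j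
    obtain h4 | h4 | h4 : a j = 1 ∨ a j = 2 ∨ a j = 3 := by omega
    · obtain ⟨y, hy, hy'⟩ := ν.hα.surj (φA (μ.α (e j)))
      exact ⟨y, by rw [h4]; exact hy, fun _ => hy', by omega⟩
    · obtain ⟨y, hy, hy'⟩ := ν.hβ.surj (φB (μ.β (e j)))
      exact ⟨y, by rw [h4]; exact hy, by omega, fun _ => hy'⟩
    -- Exponent `3` forces `n = 3`, so the generator spans a free summand, which the invariants do
    -- not see.
    · exact ⟨0, smul_zero _, by omega, by omega⟩
  choose y hy0 hyα hyβ using hy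
  obtain ⟨h, hh⟩ := he.exists_linearMap y hy0
  have h1 : ∀ (r : R) j, r • e j ∈ powTorsion ϖ 1 M → ϖ ^ (a j - 1) ∣ r →
      ν.α (h (r • e j)) = φA (μ.α (r • e j)) := by
    intro r j hr hd
    have he0 := he.pow_smul j
    obtain ⟨h1, h2⟩ := ha j
    obtain h4 | h4 | h4 : a j = 1 ∨ a j = 2 ∨ a j = 3 := by omega
    · have hm : e j ∈ powTorsion ϖ 1 M := by rw [h4] at he0; exact he0
      rw [μ.hα.smul _ _ hm, map_smul, map_smul, hh, ν.hα.smul, hyα j h4]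
      rw [← hh]
      exact map_mem_powTorsion h hm
    · have hm : e j ∈ powTorsion ϖ 2 M := by rw [h4] at he0; exact he0
      have hm' : y j ∈ powTorsion ϖ 2 N := by rw [← hh]; exact map_mem_powTorsion h hm
      rw [h4, pow_one] at hd
      obtain ⟨s, rfl⟩ := hd
      have ht : ϖ • e j ∈ powTorsion ϖ 1 M := by
        rw [mem_powTorsion, ← mul_smul, pow_one, ← pow_two]; exact hm
      have ht' : ϖ • y j ∈ powTorsion ϖ 1 N := by
        rw [mem_powTorsion, ← mul_smul, pow_one, ← pow_two]; exact hm'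
      rw [mul_comm ϖ s, mul_smul, μ.hα.smul _ _ ht, map_smul, map_smul, map_smul, hh,
        ν.hα.smul _ _ ht', ← ν.p_β _ hm', ← μ.p_β _ hm, hyβ j h4, hp]
    · have hz : r • e j ∈ powMultiples ϖ (n - 1) M := by
        have hn3 : n - 1 = a j - 1 := by omega
        obtain ⟨s, rfl⟩ := hd
        rw [hn3]
        exact ⟨s • e j, by rw [mul_smul]; rfl⟩
      rw [(μ.hα.ker _ hr).2 hz, map_zero, (ν.hα.ker _ (map_mem_powTorsion h hr)).2
        (map_mem_powMultiples h hz)]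
  have h2 : ∀ (r : R) j, r • e j ∈ powTorsion ϖ 2 M → ϖ ^ (a j - 2) ∣ r →
      ν.β (h (r • e j)) = φB (μ.β (r • e j)) := by
    intro r j hr hd
    have he0 := he.pow_smul j
    obtain ⟨h1, h2⟩ := ha j
    obtain h4 | h4 | h4 : a j = 1 ∨ a j = 2 ∨ a j = 3 := by omega
    · have hm : e j ∈ powTorsion ϖ 1 M := by rw [h4] at he0; exact he0
      have hm' : y j ∈ powTorsion ϖ 1 N := by rw [← hh]; exact map_mem_powTorsion h hm
      rw [μ.hβ.smul _ _ (powTorsion_mono (by omega) hm), map_smul, map_smul, hh,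
        ν.hβ.smul _ _ (powTorsion_mono (by omega) hm'), ← ν.ι_α _ hm', ← μ.ι_α _ hm, hyα j h4, hι]
    · have hm : e j ∈ powTorsion ϖ 2 M := by rw [h4] at he0; exact he0
      rw [μ.hβ.smul _ _ hm, map_smul, map_smul, hh, ν.hβ.smul, hyβ j h4]
      rw [← hh]
      exact map_mem_powTorsion h hm
    · have hz : r • e j ∈ powMultiples ϖ (n - 2) M := by
        have hn3 : n - 2 = a j - 2 := by omega
        obtain ⟨s, rfl⟩ := hd
        rw [hn3]
        exact ⟨s • e j, by rw [mul_smul]; rfl⟩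
      rw [(μ.hβ.ker _ hr).2 hz, map_zero, (ν.hβ.ker _ (map_mem_powTorsion h hr)).2
        (map_mem_powMultiples h hz)]
  have hmem : ∀ (b : ℕ) (r : Fin m → R), ∑ j, r j • e j ∈ powTorsion ϖ b M → ∀ j,
      r j • e j ∈ powTorsion ϖ b M := by
    intro b r hr j
    obtain ⟨s, hs⟩ := hR.coeff_dvd he (fun j => (ha j).2) (mem_powTorsion.1 hr) j
    rw [mem_powTorsion, hs, ← mul_smul, ← mul_assoc, ← pow_add,
      show b + (a j - b) = (b - a j) + a j by omega, mul_comm, pow_add, ← mul_assoc, mul_smul,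
      he.pow_smul, smul_zero]
  refine ⟨h, fun x hx => ?_, fun x hx => ?_⟩
  · obtain ⟨r, rfl⟩ := he.exists_sum x
    have hm := hmem 1 r hx
    rw [map_sum, ν.hα.map_sum _ (fun j _ => map_mem_powTorsion h (hm j)),
      μ.hα.map_sum _ (fun j _ => hm j), map_sum]
    exact Finset.sum_congr rfl fun j _ => h1 _ _ (hm j)
      (hR.coeff_dvd he (fun j => (ha j).2) (mem_powTorsion.1 hx) j)
  · obtain ⟨r, rfl⟩ := he.exists_sum x
    have hm := hmem 2 r hx
    rw [map_sum, ν.hβ.map_sum _ (fun j _ => map_mem_powTorsion h (hm j)),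
      μ.hβ.map_sum _ (fun j _ => hm j), map_sum]
    exact Finset.sum_congr rfl fun j _ => h2 _ _ (hm j)
      (hR.coeff_dvd he (fun j => (ha j).2) (mem_powTorsion.1 hx) j)

end IsChainRing

/-! ### Extending isomorphisms along a vertex -/

/-- The elements whose class modulo the range of `i` is killed by `ϖ ^ (n - 1)`. -/
def freeKer {R : Type u} [CommRing R] (ϖ : R) (n : ℕ) {P M : Type*} [AddCommGroup P] [Module R P]
    [AddCommGroup M] [Module R M] (i : P →ₗ[R] M) : Submodule R M :=
  (LinearMap.range i).comap (LinearMap.lsmul R M (ϖ ^ (n - 1)))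

theorem mem_freeKer {R : Type u} [CommRing R] {ϖ : R} {n : ℕ} {P M : Type*} [AddCommGroup P]
    [Module R P] [AddCommGroup M] [Module R M] {i : P →ₗ[R] M} {x : M} :
    x ∈ freeKer ϖ n i ↔ ∃ y, i y = ϖ ^ (n - 1) • x := Iff.rfl

theorem StablyZero.add_preserves {R : Type u} [CommRing R] {k : Type w} [Field k] {ϖ : R} {n : ℕ}
    {ρ : R →+* k} {M N : Type*} [AddCommGroup M] [Module R M] [AddCommGroup N] [Module R N]
    {X : StableObj k} {u : M →ₗ[R] N} (hu : StablyZero ϖ n u) (ν : Marking ϖ n ρ N X)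
    (h : M →ₗ[R] N) :
    (∀ x ∈ powTorsion ϖ 1 M, ν.α ((h + u) x) = ν.α (h x)) ∧
      ∀ x ∈ powTorsion ϖ 2 M, ν.β ((h + u) x) = ν.β (h x) := by
  constructor
  · intro x hx
    rw [LinearMap.add_apply, ν.hα.add _ (map_mem_powTorsion h hx) _ (map_mem_powTorsion u hx),
      (ν.hα.ker _ (map_mem_powTorsion u hx)).2 (hu.1 x hx), add_zero]
  · intro x hx
    rw [LinearMap.add_apply, ν.hβ.add _ (map_mem_powTorsion h hx) _ (map_mem_powTorsion u hx),
      (ν.hβ.ker _ (map_mem_powTorsion u hx)).2 (hu.2 x hx), add_zero]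

namespace IsChainRing

variable {R : Type u} [CommRing R] [IsLocalRing R] {k : Type w} [Field k]
  {ϖ : R} {n : ℕ} {ρ : R →+* k} (hR : IsChainRing R ϖ n ρ)

include hR

theorem pow_mul_eq_iff {r s : R} : ϖ ^ (n - 1) * r = ϖ ^ (n - 1) * s ↔ ρ r = ρ s := by
  rw [← sub_eq_zero, ← mul_sub, ← sub_eq_zero (a := ρ r), ← map_sub, hR.rho_eq_zero]
  constructor
  · intro h
    have := hR.dvd_of_pow_mul_eq_zero h
    rwa [Nat.sub_sub_self hR.pos, pow_one] at this
  · rintro ⟨t, ht⟩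
    rw [ht, ← mul_assoc, ← pow_succ, Nat.sub_add_cancel hR.pos, hR.pow_eq, zero_mul]

/-- A semilinear map to a power of `k`, followed by the embedding of `k` into `R` as the socle. -/
theorem exists_socle_map {M : Type*} [AddCommGroup M] [Module R M] {J : Type*}
    (q : M → (J → k)) (hq : IsSemilinearOn ρ ⊤ q) :
    ∃ l : M →ₗ[R] (J → R), ∀ x (r : J → R), (∀ j, ρ (r j) = q x j) →
      l x = ϖ ^ (n - 1) • r := by
  choose s hs using hR.surj
  have key : ∀ x (r : J → R), (∀ j, ρ (r j) = q x j) →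
      (fun j => ϖ ^ (n - 1) * s (q x j)) = ϖ ^ (n - 1) • r := by
    intro x r hr
    funext j
    rw [Pi.smul_apply, smul_eq_mul, hR.pow_mul_eq_iff, hs, hr]
  refine ⟨⟨⟨fun x j => ϖ ^ (n - 1) * s (q x j), fun x y => ?_⟩, fun c x => ?_⟩, key⟩
  · rw [key (x + y) (fun j => s (q x j) + s (q y j)) fun j => by
      rw [map_add, hs, hs, hq.add x trivial y trivial, Pi.add_apply]]
    funext j
    simp [mul_add]
  · change (fun j => ϖ ^ (n - 1) * s (q (c • x) j)) = _
    rw [key (c • x) (fun j => c * s (q x j)) fun j => by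
      rw [map_mul, hs, hq.smul c x trivial, Pi.smul_apply, smul_eq_mul]]
    funext j
    simp only [Pi.smul_apply, smul_eq_mul, RingHom.id_apply]
    ring

/-- Such a `γ` lives on `ϖ^(n-1)` times the cokernel of `i`. Composed with `k ≅ ϖ^(n-1) R` it is a
linear map there, which extends to the whole cokernel; the residue of the extension is `γ` again,
since `ϖ^(n-1) l x` determines `l x` modulo `ϖ`. -/
theorem exists_functional {P M : Type*} [AddCommGroup P] [Module R P]
    [AddCommGroup M] [Module R M] (i : P →ₗ[R] M) {J : Type*} {γ : M → (J → k)}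
    (hγ : IsSemilinearOn ρ ⊤ γ) (hγ0 : ∀ x ∈ freeKer ϖ n i, γ x = 0) :
    ∃ l : M →ₗ[R] (J → R), (∀ y, l (i y) = 0) ∧ ∀ x j, ρ (l x j) = γ x j := by
  obtain ⟨q, hq⟩ := hR.exists_socle_map γ hγ
  let T : M →ₗ[R] M ⧸ LinearMap.range i :=
    (LinearMap.range i).mkQ ∘ₗ LinearMap.lsmul R M (ϖ ^ (n - 1))
  obtain ⟨l, hl⟩ := LinearMap.exists_factor T.rangeRestrict T.surjective_rangeRestrict q
    (fun x hx => by
      have h1 : T x = 0 := congrArg Subtype.val hx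
      have h2 : x ∈ freeKer ϖ n i :=
        (Submodule.Quotient.mk_eq_zero (LinearMap.range i) (x := ϖ ^ (n - 1) • x)).1 h1
      rw [hq x 0 fun j => by rw [hγ0 x h2]; simp, smul_zero])
  obtain ⟨l', hl'⟩ := hR.extend (LinearMap.range T).subtype Subtype.val_injective l
  refine ⟨l' ∘ₗ (LinearMap.range i).mkQ, fun y => ?_, fun x j => ?_⟩
  · have : (LinearMap.range i).mkQ (i y) = 0 := (Submodule.Quotient.mk_eq_zero _).2 ⟨y, rfl⟩
    rw [LinearMap.comp_apply, this, map_zero]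
  · choose r hr using fun j => hR.surj (γ x j)
    rw [← hr j, ← hR.pow_mul_eq_iff]
    have h1 : ϖ ^ (n - 1) • (l' ∘ₗ (LinearMap.range i).mkQ) x = ϖ ^ (n - 1) • r := by
      rw [← hq x r hr, ← hl x, ← hl' (T.rangeRestrict x), ← map_smul]
      simp [T]
    exact congrFun h1 j

/-- The last nonzero multiple `ϖ^a x` of a nonzero element is killed by `ϖ`. -/
theorem injective_of_socle {M N : Type*} [AddCommGroup M] [Module R M] [AddCommGroup N]
    [Module R N] (h : M →ₗ[R] N) (hh : ∀ x ∈ powTorsion ϖ 1 M, h x = 0 → x = 0) :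
    Function.Injective h := by
  rw [injective_iff_map_eq_zero]
  intro x hx
  by_contra hne
  classical
  have hex : ∃ a, ϖ ^ a • x = 0 := ⟨n, by rw [hR.pow_eq, zero_smul]⟩
  have h0 : Nat.find hex ≠ 0 := fun h0 => by
    have := Nat.find_spec hex
    rw [h0, pow_zero, one_smul] at this
    exact hne this
  have h1 := Nat.find_min hex (show Nat.find hex - 1 < Nat.find hex by omega)
  refine h1 (hh _ ?_ (by rw [map_smul, hx, smul_zero]))
  rw [mem_powTorsion, ← mul_smul, ← pow_add, Nat.add_sub_cancel' (by omega)]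
  exact Nat.find_spec hex

/-- The extension step at one vertex. A stable lift is corrected twice by stably zero maps, first to
commute with `i` and `i'`, then to carry `γ` to `γ'`; neither correction disturbs the markings. -/
theorem exists_injective_lift (hn : n ≤ 3) {P M P' M' : Type*} [AddCommGroup P] [Module R P]
    [Module.Finite R P] [AddCommGroup M] [Module R M] [Module.Finite R M] [AddCommGroup P']
    [Module R P'] [AddCommGroup M'] [Module R M']
    (i : P →ₗ[R] M) (hi : Function.Injective i) (i' : P' →ₗ[R] M') (hi' : Function.Injective i')
    (G : P →ₗ[R] P') (hG : Function.Injective G) {X : StableObj k}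
    (μ : Marking ϖ n ρ M X) (μ' : Marking ϖ n ρ M' X) {Z : Type*} [AddCommGroup Z] [Module k Z]
    [Module.Finite k Z] {γ : M → Z} {γ' : M' → Z}
    (hγ : IsSubquotientMap ρ ⊤ (freeKer ϖ n i) γ) (hγ' : IsSubquotientMap ρ ⊤ (freeKer ϖ n i') γ')
    (hA : ∀ y ∈ powTorsion ϖ 1 P, μ'.α (i' (G y)) = μ.α (i y))
    (hB : ∀ y ∈ powTorsion ϖ 2 P, μ'.β (i' (G y)) = μ.β (i y)) :
    ∃ g : M →ₗ[R] M', Function.Injective g ∧ (∀ y, g (i y) = i' (G y)) ∧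
      (∀ x ∈ powTorsion ϖ 1 M, μ'.α (g x) = μ.α x) ∧
      ∀ x ∈ powTorsion ϖ 2 M, μ'.β (g x) = μ.β x := by
  obtain ⟨h₀, h₀A, h₀B⟩ := hR.exists_lift hn μ μ' LinearMap.id LinearMap.id
    (fun _ => rfl) (fun _ => rfl)
  -- The defect of commutativity is stably zero by `hA` and `hB`, so it extends from `P` to `M` as a
  -- stably zero map.
  obtain ⟨u, hu, hu0⟩ := hR.exists_extension_of_stablyZero hn i hi (i' ∘ₗ G - h₀ ∘ₗ i) (by
    constructor
    · intro x hx
      have h1 := map_mem_powTorsion i hx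
      have h2 := map_mem_powTorsion (i' ∘ₗ G) hx
      have h3 := map_mem_powTorsion h₀ h1
      refine (μ'.hα.ker _ (Submodule.sub_mem _ h2 h3)).1 ?_
      rw [μ'.hα.map_sub h2 h3, h₀A _ h1, LinearMap.comp_apply, hA x hx]
      exact sub_self _
    · intro x hx
      have h1 := map_mem_powTorsion i hx
      have h2 := map_mem_powTorsion (i' ∘ₗ G) hx
      have h3 := map_mem_powTorsion h₀ h1
      refine (μ'.hβ.ker _ (Submodule.sub_mem _ h2 h3)).1 ?_
      rw [μ'.hβ.map_sub h2 h3, h₀B _ h1, LinearMap.comp_apply, hB x hx]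
      exact sub_self _)
  obtain ⟨h, hh⟩ : ∃ h : M →ₗ[R] M', h = h₀ + u := ⟨_, rfl⟩
  have hcomm : ∀ y, h (i y) = i' (G y) := fun y => by
    rw [hh, LinearMap.add_apply, hu]; simp
  obtain ⟨τ, hτ⟩ := hγ.exists_factor hR.surj
    (hγ'.toIsSemilinearOn.comp (U := ⊤) h fun _ _ => trivial) (fun x _ hx => by
      obtain ⟨y, hy⟩ := mem_freeKer.1 hx
      refine (hγ'.ker _ trivial).2 (mem_freeKer.2 ⟨G y, ?_⟩)
      rw [← hcomm, hy, map_smul])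
  let b := Module.finBasis k Z
  obtain ⟨l, hl0, hl⟩ := hR.exists_functional i (γ := fun x j => b.equivFun (γ x) j)
    (hγ.toIsSemilinearOn.linear_comp b.equivFun.toLinearMap) (fun x hx => by
      rw [(hγ.ker x trivial).2 hx]; simp; rfl)
  -- `h` induces `τ` on `Z`, and the identity is wanted. The correction `∑ l_j v_j` supplies the
  -- difference and vanishes on the image of `i`, so the square still commutes.
  choose v _ hv using fun j => hγ'.surj (b j - τ (b j))
  let w : M →ₗ[R] M' := Fintype.linearCombination R v ∘ₗ l
  have hw : StablyZero ϖ n w := by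
    constructor <;>
    · intro x hx
      simp only [w, LinearMap.comp_apply, Fintype.linearCombination_apply]
      exact hR.comp_mem_powMultiples l v hx
  have hwγ : ∀ x, γ' (w x) = γ x - γ' (h x) := fun x => by
    simp only [w, LinearMap.comp_apply, Fintype.linearCombination_apply]
    rw [hγ'.map_sum _ fun _ _ => trivial, ← hτ x trivial]
    conv_rhs => rw [← b.sum_equivFun (γ x)]
    rw [map_sum, ← Finset.sum_sub_distrib]
    refine Finset.sum_congr rfl fun j _ => ?_
    rw [hγ'.smul _ _ trivial, hv, hl, map_smul, smul_sub]
  have hcomm' : ∀ y, (h + w) (i y) = i' (G y) := fun y => by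
    rw [LinearMap.add_apply, hcomm]
    simp [w, hl0]
  have hgA : ∀ x ∈ powTorsion ϖ 1 M, μ'.α ((h + w) x) = μ.α x := fun x hx => by
    rw [(hw.add_preserves μ' h).1 x hx, hh, (hu0.add_preserves μ' h₀).1 x hx, h₀A x hx]; rfl
  have hgB : ∀ x ∈ powTorsion ϖ 2 M, μ'.β ((h + w) x) = μ.β x := fun x hx => by
    rw [(hw.add_preserves μ' h).2 x hx, hh, (hu0.add_preserves μ' h₀).2 x hx, h₀B x hx]; rfl
  refine ⟨h + w, hR.injective_of_socle _ fun x hx hx0 => ?_, hcomm', hgA, hgB⟩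
  -- A socle element of the kernel is zero in `A`, hence is `ϖ^(n-1) z`. Then `z` is zero in `Z`, so
  -- the element comes from `P`, where `i' ∘ G` is injective.
  have h1 : μ.α x = 0 := by rw [← hgA x hx, hx0, μ'.hα.map_zero]
  obtain ⟨z, rfl⟩ := mem_powMultiples.1 ((μ.hα.ker x hx).1 h1)
  have h2 : γ z = 0 := by
    have h3 : γ' ((h + w) z) = 0 := by
      refine (hγ'.ker _ trivial).2 (mem_freeKer.2 ⟨0, ?_⟩)
      rw [map_zero, ← map_smul, hx0]
    rwa [LinearMap.add_apply, hγ'.add _ trivial _ trivial, hwγ, add_sub_cancel] at h3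
  obtain ⟨y, hy⟩ := mem_freeKer.1 ((hγ.ker z trivial).1 h2)
  rw [← hy, hcomm'] at hx0
  rw [← hy]
  have : y = 0 := hG (hi' (by rw [hx0, map_zero, map_zero]))
  rw [this, map_zero]

/-- Injective lifts exist in both directions; their composite is an injective endomorphism of an
artinian module, hence surjective. -/
theorem exists_equiv_lift (hn : n ≤ 3) {P M P' M' : Type*} [AddCommGroup P] [Module R P]
    [Module.Finite R P] [AddCommGroup M] [Module R M] [Module.Finite R M] [AddCommGroup P']
    [Module R P'] [Module.Finite R P'] [AddCommGroup M'] [Module R M'] [Module.Finite R M']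
    (i : P →ₗ[R] M) (hi : Function.Injective i) (i' : P' →ₗ[R] M') (hi' : Function.Injective i')
    (G : P ≃ₗ[R] P') {X : StableObj k}
    (μ : Marking ϖ n ρ M X) (μ' : Marking ϖ n ρ M' X) {Z : Type*} [AddCommGroup Z] [Module k Z]
    [Module.Finite k Z] {γ : M → Z} {γ' : M' → Z}
    (hγ : IsSubquotientMap ρ ⊤ (freeKer ϖ n i) γ) (hγ' : IsSubquotientMap ρ ⊤ (freeKer ϖ n i') γ')
    (hA : ∀ y ∈ powTorsion ϖ 1 P, μ'.α (i' (G y)) = μ.α (i y))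
    (hB : ∀ y ∈ powTorsion ϖ 2 P, μ'.β (i' (G y)) = μ.β (i y)) :
    ∃ g : M ≃ₗ[R] M', (∀ y, g (i y) = i' (G y)) ∧
      (∀ x ∈ powTorsion ϖ 1 M, μ'.α (g x) = μ.α x) ∧
      ∀ x ∈ powTorsion ϖ 2 M, μ'.β (g x) = μ.β x := by
  have := hR.artin
  obtain ⟨g, hg, h1, h2, h3⟩ := hR.exists_injective_lift hn i hi i' hi' G.toLinearMap G.injective
    μ μ' hγ hγ' hA hB
  obtain ⟨g', hg', -⟩ := hR.exists_injective_lift hn i' hi' i hi G.symm.toLinearMap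
    G.symm.injective μ' μ hγ' hγ
    (fun y hy => by
      have := hA _ (map_mem_powTorsion G.symm.toLinearMap hy)
      simpa using this.symm)
    (fun y hy => by
      have := hB _ (map_mem_powTorsion G.symm.toLinearMap hy)
      simpa using this.symm)
  have hs : Function.Surjective (g ∘ₗ g') :=
    IsArtinian.surjective_of_injective_endomorphism (g ∘ₗ g') (hg.comp hg')
  exact ⟨LinearEquiv.ofBijective g ⟨hg, Function.Surjective.of_comp hs⟩, h1, h2, h3⟩

end IsChainRing

/-! ### Realizing stable invariants -/

/-- The conditions satisfied by the stable invariants of modules over a chain ring of length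
`n ≤ 3`. -/
structure StableObj.IsAdmissible {k : Type w} [Field k] (n : ℕ) (X : StableObj k) : Prop where
  finite_A : Module.Finite k X.A
  finite_B : Module.Finite k X.B
  subsingleton_A : n ≤ 1 → Subsingleton X.A
  subsingleton_B : n ≤ 2 → Subsingleton X.B
  p_ι : ∀ a, X.p (X.ι a) = 0
  ι_p : ∀ b, X.ι (X.p b) = 0
  exact_A : n = 3 → ∀ a, X.ι a = 0 → ∃ b, X.p b = a
  exact_B : n = 3 → ∀ b, X.p b = 0 → ∃ a, X.ι a = b

/-- The `ρ`-semilinear map from `J → R` with given values on the standard basis. -/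
def semilinearCombination {R : Type u} [CommRing R] {k : Type w} [Field k] (ρ : R →+* k)
    {J : Type*} [Fintype J] {A : Type*} [AddCommGroup A] [Module k A] (a : J → A) :
    (J → R) →ₛₗ[ρ] A where
  toFun r := ∑ j, ρ (r j) • a j
  map_add' r s := by simp [add_smul, Finset.sum_add_distrib]
  map_smul' c r := by simp [Finset.smul_sum, mul_smul]

theorem semilinearCombination_apply {R : Type u} [CommRing R] {k : Type w} [Field k] (ρ : R →+* k)
    {J : Type*} [Fintype J] {A : Type*} [AddCommGroup A] [Module k A] (a : J → A) (r : J → R) :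
    semilinearCombination ρ a r = ∑ j, ρ (r j) • a j := rfl

/-- A family obtained from a basis of a subspace. -/
theorem exists_family_of_subspace {k : Type w} [Field k] {A : Type*} [AddCommGroup A] [Module k A]
    [Module.Finite k A] (U : Submodule k A) :
    ∃ (d : ℕ) (a : Fin d → A), (∀ x, x ∈ U ↔ ∃ c : Fin d → k, x = ∑ j, c j • a j) ∧
      ∀ c : Fin d → k, ∑ j, c j • a j = 0 → c = 0 := by
  let b := Module.finBasis k U
  have hb : ∀ c : Fin _ → k, ∑ j, c j • (b j : A) = (b.equivFun.symm c : U) := fun c => by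
    rw [b.equivFun_symm_apply]; simp
  refine ⟨_, fun j => (b j : A), fun x => ⟨fun hx => ⟨b.equivFun ⟨x, hx⟩, ?_⟩, ?_⟩, fun c hc => ?_⟩
  · rw [hb]; simp
  · rintro ⟨c, rfl⟩
    rw [hb]; exact Subtype.property _
  · rw [hb] at hc
    exact (LinearEquiv.map_eq_zero_iff b.equivFun.symm).1 (Subtype.ext hc)

/-- The `a j` and `b j` are bases of complements of `range p` in `A` and of `ker p` in `B`.
Exactness, available for `n = 3`, gives `A = ⟨a⟩ ⊕ p⟨b⟩` and `B = ι⟨a⟩ ⊕ ⟨b⟩`; the first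
decomposition holds in general. -/
theorem StableObj.exists_families {k : Type w} [Field k] {n : ℕ} {X : StableObj k}
    (hX : X.IsAdmissible n) :
    ∃ (d₁ d₂ : ℕ) (a : Fin d₁ → X.A) (b : Fin d₂ → X.B),
      (n ≤ 1 → d₁ = 0) ∧ (n ≤ 2 → d₂ = 0) ∧
      (∀ (c : Fin d₁ → k) (c' : Fin d₂ → k),
        ∑ j, c j • a j + X.p (∑ j, c' j • b j) = 0 → c = 0 ∧ c' = 0) ∧
      (∀ x, ∃ (c : Fin d₁ → k) (c' : Fin d₂ → k),
        ∑ j, c j • a j + X.p (∑ j, c' j • b j) = x) ∧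
      (n = 3 → ∀ (c : Fin d₁ → k) (c' : Fin d₂ → k),
        X.ι (∑ j, c j • a j) + ∑ j, c' j • b j = 0 → c = 0 ∧ c' = 0) ∧
      (n = 3 → ∀ y, ∃ (c : Fin d₁ → k) (c' : Fin d₂ → k),
        X.ι (∑ j, c j • a j) + ∑ j, c' j • b j = y) := by
  have := hX.finite_A
  have := hX.finite_B
  obtain ⟨A', hA'⟩ := Submodule.exists_isCompl (LinearMap.range X.p)
  obtain ⟨B', hB'⟩ := Submodule.exists_isCompl (LinearMap.ker X.p)
  obtain ⟨d₁, a, ha, ha0⟩ := exists_family_of_subspace A'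
  obtain ⟨d₂, b, hb, hb0⟩ := exists_family_of_subspace B'
  have hd : ∀ {A : Type _} [AddCommGroup A] [Module k A] (d : ℕ) (a : Fin d → A),
      (∀ c : Fin d → k, ∑ j, c j • a j = 0 → c = 0) → Subsingleton A → d = 0 := by
    intro A _ _ d a h _
    by_contra hne
    have := h (fun _ => 1) (Subsingleton.elim _ _)
    exact one_ne_zero (congrFun this ⟨0, Nat.pos_of_ne_zero hne⟩)
  have hAA : ∀ x ∈ A', ∀ y, x + X.p y = 0 → x = 0 ∧ X.p y = 0 := by
    intro x hx y hxy
    have h1 : x ∈ LinearMap.range X.p := 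
      ⟨-y, by rw [map_neg]; exact (eq_neg_of_add_eq_zero_left hxy).symm⟩
    have h2 : x = 0 := (Submodule.disjoint_def.1 hA'.disjoint) x h1 hx
    exact ⟨h2, by rwa [h2, zero_add] at hxy⟩
  have hBB : ∀ y ∈ B', X.p y = 0 → y = 0 := fun y hy h =>
    (Submodule.disjoint_def.1 hB'.disjoint) y h hy
  have hdecA : ∀ x, ∃ x' ∈ A', ∃ y, x' + X.p y = x := fun x => by
    have : x ∈ LinearMap.range X.p ⊔ A' := by rw [hA'.sup_eq_top]; trivial
    obtain ⟨_, ⟨y, rfl⟩, x', hx', h⟩ := Submodule.mem_sup.1 this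
    exact ⟨x', hx', y, by rw [add_comm]; exact h⟩
  have hdecB : ∀ y, ∃ z, X.p z = 0 ∧ ∃ y' ∈ B', z + y' = y := fun y => by
    have : y ∈ LinearMap.ker X.p ⊔ B' := by rw [hB'.sup_eq_top]; trivial
    obtain ⟨z, hz, y', hy', h⟩ := Submodule.mem_sup.1 this
    exact ⟨z, hz, y', hy', h⟩
  refine ⟨d₁, d₂, a, b, fun h => hd d₁ a ha0 (hX.subsingleton_A h),
    fun h => hd d₂ b hb0 (hX.subsingleton_B h), ?_, ?_, ?_, ?_⟩
  · intro c c' h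
    obtain ⟨h1, h2⟩ := hAA _ ((ha _).2 ⟨c, rfl⟩) _ h
    exact ⟨ha0 c h1, hb0 c' (hBB _ ((hb _).2 ⟨c', rfl⟩) h2)⟩
  · intro x
    obtain ⟨x', hx', y, rfl⟩ := hdecA x
    obtain ⟨z, hz, y', hy', rfl⟩ := hdecB y
    obtain ⟨c, rfl⟩ := (ha _).1 hx'
    obtain ⟨c', rfl⟩ := (hb _).1 hy'
    exact ⟨c, c', by rw [map_add X.p z, hz, zero_add]⟩
  · intro hn c c' h
    have h1 : X.p (∑ j, c' j • b j) = 0 := by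
      have := congrArg X.p h
      rwa [map_add, hX.p_ι, zero_add, map_zero] at this
    have h2 := hb0 c' (hBB _ ((hb _).2 ⟨c', rfl⟩) h1)
    have h3 : X.ι (∑ j, c j • a j) = 0 := by
      rw [h2] at h
      simpa using h
    obtain ⟨y, hy⟩ := hX.exact_A hn _ h3
    have h4 := (hAA _ ((ha _).2 ⟨c, rfl⟩) (-y) (by rw [map_neg, hy, add_neg_cancel])).1
    exact ⟨ha0 c h4, h2⟩
  · intro hn y
    obtain ⟨z, hz, y', hy', rfl⟩ := hdecB y
    obtain ⟨x, rfl⟩ := hX.exact_B hn z hz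
    obtain ⟨x', hx', y'', rfl⟩ := hdecA x
    obtain ⟨c, rfl⟩ := (ha _).1 hx'
    obtain ⟨c', rfl⟩ := (hb _).1 hy'
    exact ⟨c, c', by rw [map_add X.ι, hX.ι_p, add_zero]⟩

namespace IsChainRing

variable {R : Type u} [CommRing R] [IsLocalRing R] {k : Type w} [Field k]
  {ϖ : R} {n : ℕ} {ρ : R →+* k} (hR : IsChainRing R ϖ n ρ)

include hR

theorem mem_powMultiples_one_iff {J : Type*} {r : J → R} :
    r ∈ powMultiples ϖ 1 (J → R) ↔ (fun j => ρ (r j)) = 0 := by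
  rw [funext_iff]
  constructor
  · rintro ⟨s, rfl⟩ j
    simp [hR.rho_pi]
  · intro h
    choose s hs using fun j => (hR.rho_eq_zero (r j)).1 (h j)
    exact ⟨s, funext fun j => by simp [hs]⟩

theorem mem_powMultiples_of_mem_powTorsion {J : Type*} {a : ℕ} {r : J → R}
    (hr : r ∈ powTorsion ϖ a (J → R)) : r ∈ powMultiples ϖ (n - a) (J → R) := by
  choose s hs using fun j => hR.dvd_of_pow_mul_eq_zero (congrFun (mem_powTorsion.1 hr) j)
  exact ⟨s, funext fun j => by simp [hs]⟩

/-- The module is `(R/ϖ)^d₁ × (R/ϖ²)^d₂`, one cyclic summand for each member of the two families. It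
has no free summand because `d₁ = 0` for `n ≤ 1` and `d₂ = 0` for `n ≤ 2`. -/
theorem exists_realization (hn : n ≤ 3) {X : StableObj k} (hX : X.IsAdmissible n) :
    ∃ (N : Type u) (_ : AddCommGroup N) (_ : Module R N) (_ : Module.Finite R N)
      (_ : Marking ϖ n ρ N X), ∀ x : N, ϖ ^ (n - 1) • x = 0 := by
  obtain ⟨d₁, d₂, a, b, hd₁, hd₂, hA0, hA1, hB0, hB1⟩ := X.exists_families hX
  let L : Submodule R ((Fin d₁ → R) × (Fin d₂ → R)) :=
    (powMultiples ϖ 1 (Fin d₁ → R)).prod (powMultiples ϖ 2 (Fin d₂ → R))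
  have hL : ∀ y : ((Fin d₁ → R) × (Fin d₂ → R)), L.mkQ y = 0 ↔
      y.1 ∈ powMultiples ϖ 1 (Fin d₁ → R) ∧ y.2 ∈ powMultiples ϖ 2 (Fin d₂ → R) := fun y =>
    Submodule.Quotient.mk_eq_zero L
  have hsub : n ≤ 2 → ∀ v : Fin d₂ → R, v = 0 := fun h v => by
    have := hd₂ h
    subst this
    exact Subsingleton.elim _ _
  have hsub' : n ≤ 1 → ∀ v : Fin d₁ → R, v = 0 := fun h v => by
    have := hd₁ h
    subst this
    exact Subsingleton.elim _ _
  have hone : ∀ v : Fin d₂ → R, ϖ • v ∈ powMultiples ϖ 2 (Fin d₂ → R) ↔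
      v ∈ powMultiples ϖ 1 (Fin d₂ → R) := fun v => by
    rcases Nat.lt_or_ge 2 n with h | h
    · constructor
      · rintro ⟨t, ht⟩
        have h1 : v - ϖ • t ∈ powTorsion ϖ 1 (Fin d₂ → R) := by
          rw [mem_powTorsion, pow_one, smul_sub, ← ht, smul_smul, LinearMap.lsmul_apply, pow_two,
            sub_self]
        have h2 := powMultiples_anti (show 1 ≤ n - 1 by omega)
          (hR.mem_powMultiples_of_mem_powTorsion h1)
        have h3 : ϖ • t ∈ powMultiples ϖ 1 (Fin d₂ → R) := ⟨t, by simp⟩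
        simpa using Submodule.add_mem _ h2 h3
      · rintro ⟨t, rfl⟩
        exact ⟨t, by simp [pow_two, mul_smul]⟩
    · rw [hsub h v]; simp
  have hkill : ∀ x : ((Fin d₁ → R) × (Fin d₂ → R)) ⧸ L, ϖ ^ (n - 1) • x = 0 := fun x => by
    obtain ⟨y, rfl⟩ := L.mkQ_surjective x
    rw [← map_smul, hL]
    constructor
    · rcases Nat.lt_or_ge 1 n with h | h
      · exact powMultiples_anti (show 1 ≤ n - 1 by omega) ⟨y.1, rfl⟩
      · rw [Prod.smul_fst, hsub' h y.1, smul_zero]; exact Submodule.zero_mem _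
    · rcases Nat.lt_or_ge 2 n with h | h
      · exact powMultiples_anti (show 2 ≤ n - 1 by omega) ⟨y.2, rfl⟩
      · rw [Prod.smul_snd, hsub h y.2, smul_zero]; exact Submodule.zero_mem _
  let s := semilinearCombination ρ a
  let t := semilinearCombination ρ b
  have hs : ∀ r, s r = ∑ j, ρ (r j) • a j := fun r => rfl
  have ht : ∀ r, t r = ∑ j, ρ (r j) • b j := fun r => rfl
  let gα : ((Fin d₁ → R) × (Fin d₂ → R)) →ₛₗ[ρ] X.A :=
    { toFun := fun y => s y.1 + X.p (t y.2)
      map_add' := fun y z => by simp only [Prod.fst_add, Prod.snd_add, map_add]; abel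
      map_smul' := fun c y => by
        simp only [Prod.smul_fst, Prod.smul_snd, map_smulₛₗ, smul_add, RingHom.id_apply] }
  let gβ : ((Fin d₁ → R) × (Fin d₂ → R)) →ₛₗ[ρ] X.B :=
    { toFun := fun y => X.ι (s y.1) + t y.2
      map_add' := fun y z => by simp only [Prod.fst_add, Prod.snd_add, map_add]; abel
      map_smul' := fun c y => by
        simp only [Prod.smul_fst, Prod.smul_snd, map_smulₛₗ, smul_add, RingHom.id_apply] }
  -- Parametrizes the socle: the socle of `R/ϖ²` is `ϖR/ϖ²`, whence the factor `ϖ` on the second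
  -- component and the `p` in `gα`.
  let Tα : ((Fin d₁ → R) × (Fin d₂ → R)) →ₗ[R] ((Fin d₁ → R) × (Fin d₂ → R)) ⧸ L :=
    L.mkQ ∘ₗ (LinearMap.id.prodMap (LinearMap.lsmul R (Fin d₂ → R) ϖ))
  have hTα : ∀ y : ((Fin d₁ → R) × (Fin d₂ → R)), Tα y = L.mkQ (y.1, ϖ • y.2) := fun y => rfl
  have lift₁ : ∀ c : Fin d₁ → k, ∃ r : Fin d₁ → R, (fun j => ρ (r j)) = c := fun c => by
    choose r hr using fun j => hR.surj (c j)
    exact ⟨r, funext hr⟩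
  have lift₂ : ∀ c : Fin d₂ → k, ∃ r : Fin d₂ → R, (fun j => ρ (r j)) = c := fun c => by
    choose r hr using fun j => hR.surj (c j)
    exact ⟨r, funext hr⟩
  have hzero : ∀ y : ((Fin d₁ → R) × (Fin d₂ → R)), y.1 ∈ powMultiples ϖ 1 (Fin d₁ → R) →
      y.2 ∈ powMultiples ϖ 1 (Fin d₂ → R) →
      s y.1 = 0 ∧ t y.2 = 0 := fun y h1 h2 => by
    rw [hR.mem_powMultiples_one_iff, funext_iff] at h1 h2
    simp only [Pi.zero_apply] at h1 h2
    rw [hs, ht]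
    simp [h1, h2]
  obtain ⟨α, hα, hα'⟩ := exists_isSubquotientMap_of_param
    (V := powTorsion ϖ 1 (((Fin d₁ → R) × (Fin d₂ → R)) ⧸ L))
    (W := powMultiples ϖ (n - 1) (((Fin d₁ → R) × (Fin d₂ → R)) ⧸ L)) Tα gα
    (fun x => by
      obtain ⟨c, c', rfl⟩ := hA1 x
      obtain ⟨r, rfl⟩ := lift₁ c
      obtain ⟨r', rfl⟩ := lift₂ c'
      exact ⟨(r, r'), rfl⟩)
    (fun x => by
      constructor
      · intro hx
        obtain ⟨y, rfl⟩ := L.mkQ_surjective x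
        rw [mem_powTorsion, ← map_smul, hL, pow_one, Prod.smul_snd, hone] at hx
        obtain ⟨z, hz⟩ := hx.2
        refine ⟨(y.1, z), ?_⟩
        rw [hTα]
        congr 1
        exact Prod.ext rfl (by simpa using hz)
      · rintro ⟨y, rfl⟩
        rw [mem_powTorsion, hTα, ← map_smul, hL]
        exact ⟨⟨y.1, rfl⟩, ⟨y.2, by simp [pow_two, mul_smul]⟩⟩)
    (fun y => by
      have h1 : Tα y ∈ powMultiples ϖ (n - 1) (((Fin d₁ → R) × (Fin d₂ → R)) ⧸ L) ↔ Tα y = 0 :=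
        ⟨fun ⟨z, hz⟩ => by rw [← hz]; exact hkill z, fun h => by rw [h]; exact Submodule.zero_mem _⟩
      rw [h1, hTα, hL]
      change y.1 ∈ _ ∧ ϖ • y.2 ∈ _ ↔ s y.1 + X.p (t y.2) = 0
      rw [hone]
      constructor
      · rintro ⟨h1, h2⟩
        rw [(hzero y h1 h2).1, (hzero y h1 h2).2, map_zero, add_zero]
      · intro h
        rw [hR.mem_powMultiples_one_iff, hR.mem_powMultiples_one_iff]
        exact hA0 _ _ h)
  obtain ⟨β, hβ, hβ'⟩ := exists_isSubquotientMap_of_param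
    (V := powTorsion ϖ 2 (((Fin d₁ → R) × (Fin d₂ → R)) ⧸ L))
    (W := powMultiples ϖ (n - 2) (((Fin d₁ → R) × (Fin d₂ → R)) ⧸ L)) L.mkQ gβ
    (fun x => by
      rcases Nat.lt_or_ge 2 n with h | h
      · obtain ⟨c, c', rfl⟩ := hB1 (by omega) x
        obtain ⟨r, rfl⟩ := lift₁ c
        obtain ⟨r', rfl⟩ := lift₂ c'
        exact ⟨(r, r'), rfl⟩
      · have := hX.subsingleton_B h
        exact ⟨0, Subsingleton.elim _ _⟩)
    (fun x => by
      refine ⟨fun _ => L.mkQ_surjective x, ?_⟩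
      rintro ⟨y, rfl⟩
      rw [mem_powTorsion, ← map_smul, hL]
      exact ⟨powMultiples_anti (show 1 ≤ 2 by omega) ⟨y.1, rfl⟩, ⟨y.2, rfl⟩⟩)
    (fun y => by
      rcases Nat.lt_or_ge 2 n with h | h
      · have hn3 : n - 2 = 1 := by omega
        rw [hn3]
        constructor
        · rintro ⟨x, hx⟩
          obtain ⟨z, rfl⟩ := L.mkQ_surjective x
          have h1 : L.mkQ (y - ϖ • z) = 0 := by
            rw [map_sub, ← hx, map_smul]; simp
          rw [hL] at h1
          have h2 : (y - ϖ • z).2 ∈ powMultiples ϖ 1 (Fin d₂ → R) :=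
            powMultiples_anti (by omega) h1.2
          have h3 : y.1 ∈ powMultiples ϖ 1 (Fin d₁ → R) := by
            have : ϖ • z.1 ∈ powMultiples ϖ 1 (Fin d₁ → R) := ⟨z.1, by simp⟩
            simpa using Submodule.add_mem _ h1.1 this
          have h4 : y.2 ∈ powMultiples ϖ 1 (Fin d₂ → R) := by
            have : ϖ • z.2 ∈ powMultiples ϖ 1 (Fin d₂ → R) := ⟨z.2, by simp⟩
            simpa using Submodule.add_mem _ h2 this
          change X.ι (s y.1) + t y.2 = 0
          rw [(hzero y h3 h4).1, (hzero y h3 h4).2, map_zero, add_zero]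
        · intro h0
          obtain ⟨h1, h2⟩ := hB0 (by omega) _ _ h0
          obtain ⟨z, hz⟩ := hR.mem_powMultiples_one_iff.2 h1
          obtain ⟨z', hz'⟩ := hR.mem_powMultiples_one_iff.2 h2
          exact ⟨L.mkQ (z, z'), by
            rw [LinearMap.lsmul_apply, ← map_smul]
            congr 1
            exact Prod.ext hz hz'⟩
      · have := hX.subsingleton_B h
        refine ⟨fun _ => Subsingleton.elim _ _, fun _ => ?_⟩
        rw [show n - 2 = 0 by omega]
        exact ⟨L.mkQ y, by simp⟩)
  refine ⟨((Fin d₁ → R) × (Fin d₂ → R)) ⧸ L, inferInstance, inferInstance, inferInstance,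
    ⟨α, β, hα, hβ, ?_, ?_⟩, hkill⟩
  · intro x hx
    obtain ⟨y, rfl⟩ := L.mkQ_surjective x
    rw [mem_powTorsion, ← map_smul, hL, pow_one, Prod.smul_snd, hone] at hx
    obtain ⟨z, hz⟩ := hx.2
    have hy : L.mkQ y = Tα (y.1, z) := by
      rw [hTα]
      congr 1
      exact Prod.ext rfl (by simpa using hz.symm)
    have h0 : t y.2 = 0 := (hzero (0, y.2) (Submodule.zero_mem _) hx.2).2
    rw [hβ']
    conv_lhs => rw [hy, hα']
    change X.ι (s y.1 + X.p (t z)) = X.ι (s y.1) + t y.2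
    rw [map_add, hX.ι_p, h0]
  · intro x _
    obtain ⟨y, rfl⟩ := L.mkQ_surjective x
    have hy : ϖ • L.mkQ y = Tα (0, y.2) := by
      rw [hTα, ← map_smul, ← sub_eq_zero, ← map_sub, hL]
      exact ⟨⟨y.1, by simp⟩, by simp⟩
    rw [hy, hα', hβ']
    change X.p (X.ι (s y.1) + t y.2) = s 0 + X.p (t y.2)
    rw [map_add, hX.p_ι, map_zero]

/-- The free summand `R^d` serves to embed `ker h`, and the second one, of rank `dim Z`, is not hit
by `P`. Adding free modules leaves the stable invariants of `N` unchanged. -/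
theorem exists_vertex {P : Type*} {N : Type u} [AddCommGroup P] [Module R P] [Module.Finite R P]
    [AddCommGroup N] [Module R N] [Module.Finite R N] {X : StableObj k} (μ : Marking ϖ n ρ N X)
    (hN : ∀ x : N, ϖ ^ (n - 1) • x = 0) (h : P →ₗ[R] N) (Z : Type*) [AddCommGroup Z] [Module k Z]
    [Module.Finite k Z] :
    ∃ (M : Type u) (_ : AddCommGroup M) (_ : Module R M) (_ : Module.Finite R M)
      (ν : Marking ϖ n ρ M X) (i : P →ₗ[R] M) (γ : M → Z), Function.Injective i ∧
      IsSubquotientMap ρ ⊤ (freeKer ϖ n i) γ ∧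
      (∀ y ∈ powTorsion ϖ 1 P, ν.α (i y) = μ.α (h y)) ∧
      ∀ y ∈ powTorsion ϖ 2 P, ν.β (i y) = μ.β (h y) := by
  have := hR.noeth
  -- The socle of `ker h`. Taking `d` to be exactly its dimension makes `e` map `K` onto the socle
  -- of `R^d`, so that `R^d` contributes nothing to `Z`.
  let K : Submodule R P := LinearMap.ker h ⊓ powTorsion ϖ 1 P
  obtain ⟨d, f, hf⟩ := hR.exists_isSubquotientMap K ⊥ (fun x hx => by
    have := mem_powTorsion.1 hx.2
    rw [pow_one] at this
    rw [this]; exact Submodule.zero_mem _)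
  obtain ⟨l, hl⟩ := hR.exists_socle_map (M := K) (fun x => f x)
    (hf.toIsSemilinearOn.comp (U := ⊤) K.subtype fun x _ => x.2)
  obtain ⟨e, he⟩ := hR.extend K.subtype Subtype.val_injective l
  let b := Module.finBasis k Z
  let F := (Fin d → R) × (Fin (Module.finrank k Z) → R)
  have hF : ∀ (a : ℕ) (x : F), x ∈ powTorsion ϖ a F → x ∈ powMultiples ϖ (n - a) F := by
    intro a x hx
    obtain ⟨y, hy⟩ := hR.mem_powMultiples_of_mem_powTorsion
      (map_mem_powTorsion (LinearMap.fst R (Fin d → R) (Fin (Module.finrank k Z) → R)) hx)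
    obtain ⟨z, hz⟩ := hR.mem_powMultiples_of_mem_powTorsion
      (map_mem_powTorsion (LinearMap.snd R (Fin d → R) (Fin (Module.finrank k Z) → R)) hx)
    exact ⟨(y, z), Prod.ext hy hz⟩
  have hfst : ∀ (a : ℕ) (x : N × F), x ∈ powTorsion ϖ a (N × F) → x.1 ∈ powTorsion ϖ a N :=
    fun a x hx => map_mem_powTorsion (LinearMap.fst R N F) hx
  have hker : ∀ (a : ℕ) (x : N × F), x ∈ powTorsion ϖ a (N × F) →
      (x.1 ∈ powMultiples ϖ (n - a) N ↔ x ∈ powMultiples ϖ (n - a) (N × F)) := by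
    intro a x hx
    constructor
    · rintro ⟨y, hy⟩
      obtain ⟨z, hz⟩ := hF a x.2 (map_mem_powTorsion (LinearMap.snd R N F) hx)
      exact ⟨(y, z), Prod.ext hy hz⟩
    · intro h
      exact map_mem_powMultiples (LinearMap.fst R N F) h
  have hinl : ∀ (a : ℕ) (x : N), x ∈ powTorsion ϖ a N → (x, (0 : F)) ∈ powTorsion ϖ a (N × F) :=
    fun a x hx => map_mem_powTorsion (LinearMap.inl R N F) hx
  let ν : Marking ϖ n ρ (N × F) X :=
    { α := fun x => μ.α x.1
      β := fun x => μ.β x.1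
      hα :=
        { toIsSemilinearOn := μ.hα.toIsSemilinearOn.comp (LinearMap.fst R N F) (hfst 1)
          surj := fun c => by
            obtain ⟨x, hx, rfl⟩ := μ.hα.surj c
            exact ⟨(x, 0), hinl 1 x hx, rfl⟩
          ker := fun x hx => by rw [μ.hα.ker _ (hfst 1 x hx), hker 1 x hx] }
      hβ :=
        { toIsSemilinearOn := μ.hβ.toIsSemilinearOn.comp (LinearMap.fst R N F) (hfst 2)
          surj := fun c => by
            obtain ⟨x, hx, rfl⟩ := μ.hβ.surj c
            exact ⟨(x, 0), hinl 2 x hx, rfl⟩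
          ker := fun x hx => by rw [μ.hβ.ker _ (hfst 2 x hx), hker 2 x hx] }
      ι_α := fun x hx => μ.ι_α _ (hfst 1 x hx)
      p_β := fun x hx => μ.p_β _ (hfst 2 x hx) }
  let i : P →ₗ[R] N × F := h.prod (e.prod 0)
  let γ : N × F → Z := fun x => semilinearCombination ρ b x.2.2
  have hγ0 : ∀ x, γ x = 0 ↔ ϖ ^ (n - 1) • x.2.2 = 0 := fun x => by
    have h1 : γ x = b.equivFun.symm (fun j => ρ (x.2.2 j)) := (b.equivFun_symm_apply _).symm
    rw [h1, LinearEquiv.map_eq_zero_iff, funext_iff, funext_iff]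
    refine forall_congr' fun j => ?_
    have := hR.pow_mul_eq_iff (r := x.2.2 j) (s := 0)
    rw [mul_zero, map_zero] at this
    exact this.symm
  refine ⟨N × F, inferInstance, inferInstance, inferInstance, ν, i, γ, ?_, ⟨⟨?_, ?_⟩, ?_, ?_⟩,
    fun y _ => rfl, fun y _ => rfl⟩
  · refine hR.injective_of_socle _ fun y hy h0 => ?_
    have h1 : h y = 0 := congrArg Prod.fst h0
    have h2 : e y = 0 := congrArg (fun x => x.2.1) h0
    have hyK : y ∈ K := ⟨h1, hy⟩
    have h3 : l ⟨y, hyK⟩ = 0 := by rw [← he]; exact h2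
    choose r hr using fun j => hR.surj (f y j)
    rw [hl ⟨y, hyK⟩ r hr] at h3
    have h4 : f y = 0 := funext fun j => by
      have := hR.pow_mul_eq_iff (r := r j) (s := 0)
      rw [mul_zero, map_zero, hr] at this
      exact this.1 (congrFun h3 j)
    exact (Submodule.mem_bot R).1 ((hf.ker y hyK).1 h4)
  · intro x _ y _
    exact map_add (semilinearCombination ρ b) x.2.2 y.2.2
  · intro r x _
    exact map_smulₛₗ (semilinearCombination ρ b) r x.2.2
  · intro z
    choose r hr using fun j => hR.surj (b.equivFun z j)
    refine ⟨(0, 0, r), trivial, ?_⟩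
    simp only [γ, semilinearCombination_apply, hr]
    exact b.sum_equivFun z
  · intro x _
    rw [hγ0, mem_freeKer]
    constructor
    · intro hx
      -- `y` lies in `K`, so `h y = 0`; this matches the `N`-component of `ϖ^(n-1) x` because
      -- `ϖ^(n-1)` kills `N`.
      obtain ⟨y, hy, hfy⟩ := hf.surj (fun j => ρ (x.2.1 j))
      refine ⟨y, Prod.ext ?_ (Prod.ext ?_ ?_)⟩
      · exact hy.1.trans (hN x.1).symm
      · change e y = _
        exact (he ⟨y, hy⟩).trans (hl ⟨y, hy⟩ x.2.1 fun j => (congrFun hfy j).symm)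
      · exact hx.symm
    · rintro ⟨y, hy⟩
      exact (congrArg (fun x => x.2.2) hy).symm

end IsChainRing

/-! ### Stable invariants of representations -/

section Recursion

variable {Q : Type w} [Quiver.{w'} Q]

theorem Quiver.IsAcyclic.wellFounded [Finite Q] (hQ : Quiver.IsAcyclic Q) :
    WellFounded fun j i : Q => Nonempty (j ⟶ i) := by
  have hpath : ∀ i j : Q, Relation.TransGen (fun j i : Q => Nonempty (j ⟶ i)) i j →
      ∃ p : Quiver.Path i j, p.length ≠ 0 := by
    intro i j h
    induction h with
    | single h => exact ⟨(Quiver.Path.nil).cons h.some, by simp⟩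
    | tail _ h ih =>
      obtain ⟨p, -⟩ := ih
      exact ⟨p.cons h.some, by simp⟩
  have : Std.Irrefl (Relation.TransGen (fun j i : Q => Nonempty (j ⟶ i))) := ⟨fun i h => by
    obtain ⟨p, hp⟩ := hpath i i h
    exact hp (hQ i p)⟩
  exact Subrelation.wf (fun h => Relation.TransGen.single h)
    (Finite.wellFounded_of_trans_of_irrefl (Relation.TransGen fun j i : Q => Nonempty (j ⟶ i)))

/-- Well-founded recursion along the arrows, with `S` recording how the choice at `i` fits the
choices at the sources of its incoming arrows. -/
theorem Quiver.IsAcyclic.exists_rec [Finite Q] (hQ : Quiver.IsAcyclic Q) {T : Q → Type*}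
    (S : ∀ i, (∀ a : (Σ j : Q, (j ⟶ i)), T a.1) → T i → Prop) (h : ∀ i f, ∃ t, S i f t) :
    ∃ t : ∀ i, T i, ∀ i, S i (fun a => t a.1) (t i) := by
  choose F hF using h
  refine ⟨hQ.wellFounded.fix fun i rec => F i fun a => rec a.1 ⟨a.2⟩, fun i => ?_⟩
  rw [WellFounded.fix_eq]
  exact hF i _

end Recursion

theorem IsSubquotientMap.exists_equiv {R : Type u} [CommRing R] {k : Type w} [Field k]
    {ρ : R →+* k} (hρ : Function.Surjective ρ) {M A B : Type*} [AddCommGroup M] [Module R M]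
    [AddCommGroup A] [Module k A] [AddCommGroup B] [Module k B] {V W : Submodule R M}
    {f : M → A} {g : M → B} (hf : IsSubquotientMap ρ V W f) (hg : IsSubquotientMap ρ V W g) :
    ∃ l : A ≃ₗ[k] B, ∀ x ∈ V, l (f x) = g x := by
  obtain ⟨l, hl⟩ := hf.exists_factor hρ hg.toIsSemilinearOn fun x hx hW => (hg.ker x hx).2 hW
  obtain ⟨l', hl'⟩ := hg.exists_factor hρ hf.toIsSemilinearOn fun x hx hW => (hf.ker x hx).2 hW
  refine ⟨LinearEquiv.ofLinearMap l l' ?_ ?_, hl⟩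
  · ext b
    obtain ⟨x, hx, rfl⟩ := hg.surj b
    simp [hl' x hx, hl x hx]
  · ext a
    obtain ⟨x, hx, rfl⟩ := hf.surj a
    simp [hl' x hx, hl x hx]

/-- Representations of a quiver in the category of stable invariants, with an extra vector space at
each vertex. -/
structure StableRep (Q : Type w) [Quiver.{w'} Q] (k : Type u') [Field k] where
  obj : Q → StableObj.{v} k
  Z : Q → Type v
  [addCommGroupZ : ∀ i, AddCommGroup (Z i)]
  [moduleZ : ∀ i, Module k (Z i)]
  mapA : ∀ {i j : Q}, (i ⟶ j) → (obj i).A →ₗ[k] (obj j).A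
  mapB : ∀ {i j : Q}, (i ⟶ j) → (obj i).B →ₗ[k] (obj j).B
  mapB_ι : ∀ {i j : Q} (a : i ⟶ j) (x : (obj i).A), mapB a ((obj i).ι x) = (obj j).ι (mapA a x)
  mapA_p : ∀ {i j : Q} (a : i ⟶ j) (y : (obj i).B), mapA a ((obj i).p y) = (obj j).p (mapB a y)

attribute [instance] StableRep.addCommGroupZ StableRep.moduleZ

namespace StableRep

variable {Q : Type w} [Quiver.{w'} Q] {k : Type u'} [Field k]

/-- The conditions satisfied by the stable invariants of representations over a chain ring of length
`n ≤ 3`. -/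
structure IsAdmissible (n : ℕ) (X : StableRep.{v} Q k) : Prop where
  obj : ∀ i, (X.obj i).IsAdmissible n
  finite_Z : ∀ i, Module.Finite k (X.Z i)

/-- The direct sum. -/
def directSum (X Y : StableRep.{v} Q k) : StableRep.{v} Q k where
  obj i :=
    { A := (X.obj i).A × (Y.obj i).A
      B := (X.obj i).B × (Y.obj i).B
      ι := (X.obj i).ι.prodMap (Y.obj i).ι
      p := (X.obj i).p.prodMap (Y.obj i).p }
  Z i := X.Z i × Y.Z i
  mapA a := (X.mapA a).prodMap (Y.mapA a)
  mapB a := (X.mapB a).prodMap (Y.mapB a)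
  mapB_ι a x := Prod.ext (X.mapB_ι a x.1) (Y.mapB_ι a x.2)
  mapA_p a x := Prod.ext (X.mapA_p a x.1) (Y.mapA_p a x.2)

end StableRep

namespace QuiverRep

variable {Q : Type w} [Quiver.{w'} Q] [Fintype Q] [∀ i j : Q, Fintype (i ⟶ j)]
  {R : Type u} [CommRing R]

theorem inMap_apply (M : QuiverRep Q R) (i : Q) (y : ∀ a : (Σ j : Q, (j ⟶ i)), M.obj a.1) :
    M.inMap i y = ∑ a : (Σ j : Q, (j ⟶ i)), M.map a.2 (y a) := by
  simp [inMap, LinearMap.sum_apply]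

theorem inMap_directSum (M N : QuiverRep Q R) (i : Q)
    (y : ∀ a : (Σ j : Q, (j ⟶ i)), (M.directSum N).obj a.1) :
    (M.directSum N).inMap i y =
      (M.inMap i (fun a => (y a).1), N.inMap i (fun a => (y a).2)) := by
  rw [inMap_apply, inMap_apply, inMap_apply]
  refine Prod.ext ?_ ?_
  · exact map_sum (LinearMap.fst R (M.obj i) (N.obj i)) _ _
  · exact map_sum (LinearMap.snd R (M.obj i) (N.obj i)) _ _

theorem IsMono.directSum {M N : QuiverRep Q R} (hM : M.IsMono) (hN : N.IsMono) :
    (M.directSum N).IsMono := by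
  intro i y z h
  have h' := (inMap_directSum M N i y).symm.trans (h.trans (inMap_directSum M N i z))
  funext a
  exact Prod.ext (congrFun (hM i (congrArg Prod.fst h')) a)
    (congrFun (hN i (congrArg Prod.snd h')) a)

theorem mem_freeKer_directSum {ϖ : R} {n : ℕ} {M N : QuiverRep Q R} {i : Q}
    (x : (M.directSum N).obj i) : x ∈ freeKer ϖ n ((M.directSum N).inMap i) ↔
      x.1 ∈ freeKer ϖ n (M.inMap i) ∧ x.2 ∈ freeKer ϖ n (N.inMap i) := by
  constructor
  · intro hx
    obtain ⟨y, hy⟩ := mem_freeKer.1 hx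
    have hy' := (inMap_directSum M N i y).symm.trans hy
    exact ⟨⟨_, congrArg Prod.fst hy'⟩, ⟨_, congrArg Prod.snd hy'⟩⟩
  · rintro ⟨⟨y, hy⟩, ⟨z, hz⟩⟩
    exact mem_freeKer.2 ⟨fun a => (y a, z a), (inMap_directSum M N i _).trans (Prod.ext hy hz)⟩

theorem Iso.inMap_equiv {M N : QuiverRep Q R} (e : M.Iso N) (i : Q)
    (y : ∀ a : (Σ j : Q, (j ⟶ i)), M.obj a.1) :
    e.equiv i (M.inMap i y) = N.inMap i (fun a => e.equiv a.1 (y a)) := by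
  rw [inMap_apply, inMap_apply, map_sum]
  exact Finset.sum_congr rfl fun a _ => e.comm _ _

end QuiverRep

/-- An identification of the stable invariants of the representation `M` with `X`. -/
structure RepMarking {Q : Type w} [Quiver.{w'} Q] [Fintype Q] [∀ i j : Q, Fintype (i ⟶ j)]
    {R : Type u} [CommRing R] {k : Type u'} [Field k] (ϖ : R) (n : ℕ) (ρ : R →+* k)
    (M : QuiverRep Q R) (X : StableRep.{v} Q k) where
  mark : ∀ i, Marking ϖ n ρ (M.obj i) (X.obj i)
  γ : ∀ i, M.obj i → X.Z i
  hγ : ∀ i, IsSubquotientMap ρ ⊤ (freeKer ϖ n (M.inMap i)) (γ i)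
  map_α : ∀ {i j : Q} (a : i ⟶ j), ∀ x ∈ powTorsion ϖ 1 (M.obj i),
    (mark j).α (M.map a x) = X.mapA a ((mark i).α x)
  map_β : ∀ {i j : Q} (a : i ⟶ j), ∀ x ∈ powTorsion ϖ 2 (M.obj i),
    (mark j).β (M.map a x) = X.mapB a ((mark i).β x)

theorem proj_mem_powTorsion {R : Type*} [CommRing R] {ϖ : R} {J : Type*} {M : J → Type*}
    [∀ j, AddCommGroup (M j)] [∀ j, Module R (M j)] {a : ℕ} {y : ∀ j, M j}
    (hy : y ∈ powTorsion ϖ a (∀ j, M j)) (j : J) : y j ∈ powTorsion ϖ a (M j) :=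
  map_mem_powTorsion (LinearMap.proj j) hy

section Product

variable {R : Type u} [CommRing R] (ϖ : R) (a : ℕ) (M N : Type*) [AddCommGroup M] [Module R M]
  [AddCommGroup N] [Module R N]

theorem powTorsion_prod :
    powTorsion ϖ a (M × N) = (powTorsion ϖ a M).prod (powTorsion ϖ a N) := by
  ext x
  rw [Submodule.mem_prod, mem_powTorsion, mem_powTorsion, mem_powTorsion, Prod.ext_iff]
  rfl

theorem powMultiples_prod :
    powMultiples ϖ a (M × N) = (powMultiples ϖ a M).prod (powMultiples ϖ a N) := by
  ext x
  rw [Submodule.mem_prod, mem_powMultiples, mem_powMultiples, mem_powMultiples]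
  constructor
  · rintro ⟨z, rfl⟩
    exact ⟨⟨z.1, rfl⟩, ⟨z.2, rfl⟩⟩
  · rintro ⟨⟨y, hy⟩, ⟨z, hz⟩⟩
    exact ⟨(y, z), Prod.ext hy hz⟩

end Product

namespace RepMarking

variable {Q : Type w} [Quiver.{w'} Q] [Fintype Q] [∀ i j : Q, Fintype (i ⟶ j)]
  {R : Type u} [CommRing R] {k : Type u'} [Field k] {ϖ : R} {n : ℕ} {ρ : R →+* k}

/-- Transport of a marking along an isomorphism. -/
def ofIso {M N : QuiverRep Q R} {X : StableRep.{v} Q k} (e : M.Iso N)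
    (ν : RepMarking ϖ n ρ N X) : RepMarking ϖ n ρ M X :=
  have hT : ∀ (i : Q) (a : ℕ) (x : M.obj i),
      x ∈ powTorsion ϖ a (M.obj i) ↔ e.equiv i x ∈ powTorsion ϖ a (N.obj i) := fun i a x =>
    ⟨fun hx => map_mem_powTorsion (e.equiv i).toLinearMap hx, fun hx => by
      have := map_mem_powTorsion (e.equiv i).symm.toLinearMap hx
      simpa using this⟩
  have hP : ∀ (i : Q) (a : ℕ) (x : M.obj i),
      x ∈ powMultiples ϖ a (M.obj i) ↔ e.equiv i x ∈ powMultiples ϖ a (N.obj i) := fun i a x =>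
    ⟨fun hx => map_mem_powMultiples (e.equiv i).toLinearMap hx, fun hx => by
      have := map_mem_powMultiples (e.equiv i).symm.toLinearMap hx
      simpa using this⟩
  { mark := fun i =>
      { α := fun x => (ν.mark i).α (e.equiv i x)
        β := fun x => (ν.mark i).β (e.equiv i x)
        hα := (ν.mark i).hα.comp_linearEquiv (e.equiv i) (hT i 1) (hP i (n - 1))
        hβ := (ν.mark i).hβ.comp_linearEquiv (e.equiv i) (hT i 2) (hP i (n - 2))
        ι_α := fun x hx => (ν.mark i).ι_α _ ((hT i 1 x).1 hx)
        p_β := fun x hx => by rw [(ν.mark i).p_β _ ((hT i 2 x).1 hx), map_smul] }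
    γ := fun i x => ν.γ i (e.equiv i x)
    hγ := fun i => (ν.hγ i).comp_linearEquiv (e.equiv i) (fun _ => Iff.rfl) fun x => by
      rw [mem_freeKer, mem_freeKer]
      constructor
      · rintro ⟨y, hy⟩
        exact ⟨_, by rw [← e.inMap_equiv, hy, map_smul]⟩
      · rintro ⟨y, hy⟩
        refine ⟨fun a => (e.equiv a.1).symm (y a), (e.equiv i).injective ?_⟩
        rw [e.inMap_equiv, map_smul, ← hy]
        simp
    map_α := fun {i j} a x hx => by
      change (ν.mark j).α (e.equiv j (M.map a x)) = X.mapA a ((ν.mark i).α (e.equiv i x))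
      rw [e.comm, ν.map_α a _ ((hT i 1 x).1 hx)]
    map_β := fun {i j} a x hx => by
      change (ν.mark j).β (e.equiv j (M.map a x)) = X.mapB a ((ν.mark i).β (e.equiv i x))
      rw [e.comm, ν.map_β a _ ((hT i 2 x).1 hx)] }

/-- The direct sum of markings. -/
def directSum {M N : QuiverRep Q R} {X Y : StableRep.{v} Q k} (μ : RepMarking ϖ n ρ M X)
    (ν : RepMarking ϖ n ρ N Y) : RepMarking ϖ n ρ (M.directSum N) (X.directSum Y) where
  mark i :=
    { α := fun x => ((μ.mark i).α x.1, (ν.mark i).α x.2)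
      β := fun x => ((μ.mark i).β x.1, (ν.mark i).β x.2)
      hα := by
        have := (μ.mark i).hα.prod (ν.mark i).hα
        rwa [← powTorsion_prod, ← powMultiples_prod] at this
      hβ := by
        have := (μ.mark i).hβ.prod (ν.mark i).hβ
        rwa [← powTorsion_prod, ← powMultiples_prod] at this
      ι_α := fun x hx => by
        have hx' : x ∈ (powTorsion ϖ 1 (M.obj i)).prod (powTorsion ϖ 1 (N.obj i)) := by
          rwa [← powTorsion_prod]
        exact Prod.ext ((μ.mark i).ι_α _ hx'.1) ((ν.mark i).ι_α _ hx'.2)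
      p_β := fun x hx => by
        have hx' : x ∈ (powTorsion ϖ 2 (M.obj i)).prod (powTorsion ϖ 2 (N.obj i)) := by
          rwa [← powTorsion_prod]
        exact Prod.ext ((μ.mark i).p_β _ hx'.1) ((ν.mark i).p_β _ hx'.2) }
  γ i x := (μ.γ i x.1, ν.γ i x.2)
  hγ i :=
    { add := fun x _ y _ => Prod.ext ((μ.hγ i).add _ trivial _ trivial)
        ((ν.hγ i).add _ trivial _ trivial)
      smul := fun r x _ => Prod.ext ((μ.hγ i).smul r _ trivial) ((ν.hγ i).smul r _ trivial)
      surj := fun z => by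
        obtain ⟨x, -, hx⟩ := (μ.hγ i).surj z.1
        obtain ⟨y, -, hy⟩ := (ν.hγ i).surj z.2
        exact ⟨(x, y), trivial, Prod.ext hx hy⟩
      ker := fun x _ => by
        rw [QuiverRep.mem_freeKer_directSum, ← (μ.hγ i).ker _ trivial, ← (ν.hγ i).ker _ trivial]
        exact Prod.mk_eq_zero }
  map_α {i j} a x hx := by
    have hx' : x ∈ (powTorsion ϖ 1 (M.obj i)).prod (powTorsion ϖ 1 (N.obj i)) := by
      rwa [← powTorsion_prod]
    exact Prod.ext (μ.map_α a _ hx'.1) (ν.map_α a _ hx'.2)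
  map_β {i j} a x hx := by
    have hx' : x ∈ (powTorsion ϖ 2 (M.obj i)).prod (powTorsion ϖ 2 (N.obj i)) := by
      rwa [← powTorsion_prod]
    exact Prod.ext (μ.map_β a _ hx'.1) (ν.map_β a _ hx'.2)

/-- If `M` has markings by `X` and `Y`, then every representation with a marking by `X` has a
marking by `Y`. -/
theorem transfer (hρ : Function.Surjective ρ) {M : QuiverRep Q R} {X : StableRep.{v} Q k}
    {Y : StableRep.{v'} Q k} (μ : RepMarking ϖ n ρ M X) (μ' : RepMarking ϖ n ρ M Y)
    {S : Type*} [CommRing S] {ϖ' : S} {ρ' : S →+* k} {N : QuiverRep Q S}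
    (ν : RepMarking ϖ' n ρ' N X) : Nonempty (RepMarking ϖ' n ρ' N Y) := by
  choose lA hlA using fun i => (μ.mark i).hα.exists_equiv hρ (μ'.mark i).hα
  choose lB hlB using fun i => (μ.mark i).hβ.exists_equiv hρ (μ'.mark i).hβ
  choose lZ hlZ using fun i => (μ.hγ i).exists_equiv hρ (μ'.hγ i)
  have h12 : ∀ i (x : M.obj i), x ∈ powTorsion ϖ 1 (M.obj i) → x ∈ powTorsion ϖ 2 (M.obj i) :=
    fun i x hx => powTorsion_mono (by omega) hx
  have hι : ∀ i x, (Y.obj i).ι (lA i x) = lB i ((X.obj i).ι x) := fun i x => by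
    obtain ⟨m, hm, rfl⟩ := (μ.mark i).hα.surj x
    rw [hlA i m hm, (μ'.mark i).ι_α m hm, (μ.mark i).ι_α m hm, hlB i m (h12 i m hm)]
  have hp : ∀ i x, (Y.obj i).p (lB i x) = lA i ((X.obj i).p x) := fun i x => by
    obtain ⟨m, hm, rfl⟩ := (μ.mark i).hβ.surj x
    have hm' : ϖ • m ∈ powTorsion ϖ 1 (M.obj i) := by
      rw [mem_powTorsion, ← mul_smul, pow_one, ← pow_two]; exact hm
    rw [hlB i m hm, (μ'.mark i).p_β m hm, (μ.mark i).p_β m hm, hlA i _ hm']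
  have hA : ∀ {i j : Q} (a : i ⟶ j) x, Y.mapA a (lA i x) = lA j (X.mapA a x) := fun {i j} a x => by
    obtain ⟨m, hm, rfl⟩ := (μ.mark i).hα.surj x
    rw [hlA i m hm, ← μ'.map_α a m hm, ← μ.map_α a m hm, hlA j _ (map_mem_powTorsion _ hm)]
  have hB : ∀ {i j : Q} (a : i ⟶ j) x, Y.mapB a (lB i x) = lB j (X.mapB a x) := fun {i j} a x => by
    obtain ⟨m, hm, rfl⟩ := (μ.mark i).hβ.surj x
    rw [hlB i m hm, ← μ'.map_β a m hm, ← μ.map_β a m hm, hlB j _ (map_mem_powTorsion _ hm)]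
  exact ⟨
    { mark := fun i =>
        { α := fun x => lA i ((ν.mark i).α x)
          β := fun x => lB i ((ν.mark i).β x)
          hα := (ν.mark i).hα.comp_equiv (lA i)
          hβ := (ν.mark i).hβ.comp_equiv (lB i)
          ι_α := fun x hx => by rw [hι, (ν.mark i).ι_α x hx]
          p_β := fun x hx => by rw [hp, (ν.mark i).p_β x hx] }
      γ := fun i x => lZ i (ν.γ i x)
      hγ := fun i => (ν.hγ i).comp_equiv (lZ i)
      map_α := fun a x hx => (congrArg (lA _) (ν.map_α a x hx)).trans (hA a _).symm
      map_β := fun a x hx => (congrArg (lB _) (ν.map_β a x hx)).trans (hB a _).symm }⟩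

theorem α_inMap {M : QuiverRep Q R} {X : StableRep.{v} Q k} (μ : RepMarking ϖ n ρ M X) (i : Q)
    (y : ∀ a : (Σ j : Q, (j ⟶ i)), M.obj a.1) (hy : ∀ a, y a ∈ powTorsion ϖ 1 (M.obj a.1)) :
    (μ.mark i).α (M.inMap i y) = ∑ a, X.mapA a.2 ((μ.mark a.1).α (y a)) := by
  rw [QuiverRep.inMap_apply, (μ.mark i).hα.map_sum _ fun a _ => map_mem_powTorsion _ (hy a)]
  exact Finset.sum_congr rfl fun a _ => μ.map_α _ _ (hy a)

theorem β_inMap {M : QuiverRep Q R} {X : StableRep.{v} Q k} (μ : RepMarking ϖ n ρ M X) (i : Q)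
    (y : ∀ a : (Σ j : Q, (j ⟶ i)), M.obj a.1) (hy : ∀ a, y a ∈ powTorsion ϖ 2 (M.obj a.1)) :
    (μ.mark i).β (M.inMap i y) = ∑ a, X.mapB a.2 ((μ.mark a.1).β (y a)) := by
  rw [QuiverRep.inMap_apply, (μ.mark i).hβ.map_sum _ fun a _ => map_mem_powTorsion _ (hy a)]
  exact Finset.sum_congr rfl fun a _ => μ.map_β _ _ (hy a)

end RepMarking

theorem Marking.isAdmissible {R : Type u} [CommRing R] {k : Type u'} [Field k]
    {ϖ : R} {n : ℕ} {ρ : R →+* k} (hn : n ≤ 3) {M : Type*} [AddCommGroup M] [Module R M]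
    {X : StableObj.{v} k} [Module.Finite k X.A] [Module.Finite k X.B] (μ : Marking ϖ n ρ M X) :
    X.IsAdmissible n := by
  have h12 : ∀ x : M, x ∈ powTorsion ϖ 1 M → x ∈ powTorsion ϖ 2 M :=
    fun x hx => powTorsion_mono (by omega) hx
  have h21 : ∀ x : M, x ∈ powTorsion ϖ 2 M → ϖ • x ∈ powTorsion ϖ 1 M := fun x hx => by
    rw [mem_powTorsion, ← mul_smul, pow_one, ← pow_two]; exact hx
  have hϖ : ∀ x : M, ϖ • x ∈ powMultiples ϖ 1 M := fun x => ⟨x, by simp⟩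
  refine ⟨‹_›, ‹_›, fun h => ?_, fun h => ?_, fun a => ?_, fun b => ?_, fun h a ha => ?_,
    fun h b hb => ?_⟩
  · refine subsingleton_of_forall_eq 0 fun a => ?_
    obtain ⟨x, hx, rfl⟩ := μ.hα.surj a
    rw [μ.hα.ker x hx, show n - 1 = 0 by omega]
    exact ⟨x, by simp⟩
  · refine subsingleton_of_forall_eq 0 fun a => ?_
    obtain ⟨x, hx, rfl⟩ := μ.hβ.surj a
    rw [μ.hβ.ker x hx, show n - 2 = 0 by omega]
    exact ⟨x, by simp⟩
  · obtain ⟨x, hx, rfl⟩ := μ.hα.surj a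
    have : ϖ • x = 0 := by simpa using mem_powTorsion.1 hx
    rw [μ.ι_α x hx, μ.p_β x (h12 x hx), this, μ.hα.map_zero]
  · obtain ⟨x, hx, rfl⟩ := μ.hβ.surj b
    rw [μ.p_β x hx, μ.ι_α _ (h21 x hx), μ.hβ.ker _ (h12 _ (h21 x hx))]
    exact powMultiples_anti (by omega) (hϖ x)
  · obtain ⟨x, hx, rfl⟩ := μ.hα.surj a
    rw [μ.ι_α x hx, μ.hβ.ker x (h12 x hx), show n - 2 = 1 by omega] at ha
    obtain ⟨z, rfl⟩ := ha
    have hz : z ∈ powTorsion ϖ 2 M := by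
      rw [mem_powTorsion, pow_two, mul_smul]
      simpa using mem_powTorsion.1 hx
    exact ⟨μ.β z, by rw [μ.p_β z hz]; simp⟩
  · obtain ⟨x, hx, rfl⟩ := μ.hβ.surj b
    rw [μ.p_β x hx, μ.hα.ker _ (h21 x hx), show n - 1 = 2 by omega] at hb
    obtain ⟨z, hz⟩ := hb
    -- From `ϖ x = ϖ² z`, the element `x - ϖ z` is in the socle, and it has the class of `x` in `B`
    -- because `ϖ z ∈ ϖ M`.
    have h1 : x - ϖ • z ∈ powTorsion ϖ 1 M := by
      rw [mem_powTorsion, pow_one, smul_sub, ← hz, LinearMap.lsmul_apply, pow_two, mul_smul,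
        sub_self]
    have h3 : ϖ • z ∈ powTorsion ϖ 2 M := by
      have := (powTorsion ϖ 2 M).sub_mem hx (h12 _ h1)
      simpa using this
    refine ⟨μ.α (x - ϖ • z), ?_⟩
    rw [μ.ι_α _ h1, μ.hβ.map_sub hx h3, (μ.hβ.ker _ h3).2, sub_zero]
    rw [show n - 2 = 1 by omega]
    exact hϖ z

namespace IsChainRing

variable {R : Type u} [CommRing R] [IsLocalRing R] {k : Type u'} [Field k]
  {ϖ : R} {n : ℕ} {ρ : R →+* k} (hR : IsChainRing R ϖ n ρ)
  {Q : Type w} [Quiver.{w'} Q] [Fintype Q] [∀ i j : Q, Fintype (i ⟶ j)]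

include hR

/-- Representations in the monomorphism category with the same stable invariants are isomorphic. -/
theorem nonempty_iso (hn : n ≤ 3) (hQ : Quiver.IsAcyclic Q) {M N : QuiverRep Q R}
    (hM : M.IsMono) (hN : N.IsMono) {X : StableRep.{v} Q k} (hX : X.IsAdmissible n)
    (μ : RepMarking ϖ n ρ M X) (ν : RepMarking ϖ n ρ N X) : Nonempty (M.Iso N) := by
  obtain ⟨g, hg⟩ := hQ.exists_rec
    (T := fun i => {g : M.obj i ≃ₗ[R] N.obj i //
      (∀ x ∈ powTorsion ϖ 1 (M.obj i), (ν.mark i).α (g x) = (μ.mark i).α x) ∧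
      ∀ x ∈ powTorsion ϖ 2 (M.obj i), (ν.mark i).β (g x) = (μ.mark i).β x})
    (fun i f g => ∀ y : (∀ a : (Σ j : Q, (j ⟶ i)), M.obj a.1),
      g.1 (M.inMap i y) = N.inMap i (fun a => (f a).1 (y a))) (by
    intro i f
    have := hX.finite_Z i
    obtain ⟨g, h1, h2, h3⟩ := hR.exists_equiv_lift hn (M.inMap i) (hM i) (N.inMap i) (hN i)
      (LinearEquiv.piCongrRight fun a => (f a).1) (μ.mark i) (ν.mark i) (μ.hγ i) (ν.hγ i)
      (fun y hy => by
        have hy' := proj_mem_powTorsion hy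
        rw [μ.α_inMap i y hy', ν.α_inMap]
        · exact Finset.sum_congr rfl fun a _ => congrArg _ ((f a).2.1 _ (hy' a))
        · exact fun a => map_mem_powTorsion (f a).1.toLinearMap (hy' a))
      (fun y hy => by
        have hy' := proj_mem_powTorsion hy
        rw [μ.β_inMap i y hy', ν.β_inMap]
        · exact Finset.sum_congr rfl fun a _ => congrArg _ ((f a).2.2 _ (hy' a))
        · exact fun a => map_mem_powTorsion (f a).1.toLinearMap (hy' a))
    exact ⟨⟨g, h2, h3⟩, h1⟩)
  classical
  refine ⟨⟨fun i => (g i).1, fun {i j} a x => ?_⟩⟩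
  -- Families supported on one arrow turn compatibility with `inMap` into compatibility with that
  -- arrow.
  have h := hg j (Pi.single (M := fun a : (Σ i : Q, (i ⟶ j)) => M.obj a.1) ⟨i, a⟩ x)
  rw [QuiverRep.inMap_apply, QuiverRep.inMap_apply, Finset.sum_eq_single ⟨i, a⟩,
    Finset.sum_eq_single ⟨i, a⟩, Pi.single_eq_same] at h
  · exact h
  · intro b _ hb
    rw [Pi.single_eq_of_ne hb, map_zero, map_zero]
  · simp
  · intro b _ hb
    rw [Pi.single_eq_of_ne hb, map_zero]
  · simp

theorem exists_marking (hn : n ≤ 3) (M : Type*) [AddCommGroup M] [Module R M]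
    [Module.Finite R M] :
    ∃ X : StableObj.{u'} k, X.IsAdmissible n ∧ Nonempty (Marking ϖ n ρ M X) := by
  have h12 : powTorsion ϖ 1 M ≤ powTorsion ϖ 2 M := powTorsion_mono (by omega)
  have h21 : ∀ x ∈ powTorsion ϖ 2 M, LinearMap.lsmul R M ϖ x ∈ powTorsion ϖ 1 M := fun x hx => by
    rw [LinearMap.lsmul_apply, mem_powTorsion, ← mul_smul, pow_one, ← pow_two]; exact hx
  obtain ⟨dA, α, hα⟩ := hR.exists_isSubquotientMap (powTorsion ϖ 1 M) (powMultiples ϖ (n - 1) M)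
    (fun x hx => by
      have : ϖ • x = 0 := by simpa using mem_powTorsion.1 hx
      rw [this]; exact Submodule.zero_mem _)
  obtain ⟨dB, β, hβ⟩ := hR.exists_isSubquotientMap (powTorsion ϖ 2 M) (powMultiples ϖ (n - 2) M)
    -- For `n ≤ 3` the subquotient `B` is killed by `ϖ`; for larger `n` it need not be a vector
    -- space over `k`.
    (fun x hx => powMultiples_anti (show n - 2 ≤ 1 by omega) ⟨x, by simp⟩)
  obtain ⟨ι, hι⟩ := hα.exists_factor hR.surj (hβ.toIsSemilinearOn.mono h12) fun x hx hW =>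
    (hβ.ker x (h12 hx)).2 (powMultiples_anti (by omega) hW)
  obtain ⟨p, hp⟩ := hβ.exists_factor hR.surj
    (hα.toIsSemilinearOn.comp (LinearMap.lsmul R M ϖ) h21) (fun x hx hW => by
      refine (hα.ker _ (h21 x hx)).2 ?_
      obtain ⟨z, rfl⟩ := hW
      refine powMultiples_anti (show n - 1 ≤ n - 2 + 1 by omega) ⟨z, ?_⟩
      simp only [LinearMap.lsmul_apply]
      rw [← mul_smul, pow_succ'])
  let X : StableObj.{u'} k := { A := Fin dA → k, B := Fin dB → k, ι := ι, p := p }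
  let μ : Marking ϖ n ρ M X := ⟨α, β, hα, hβ, hι, hp⟩
  have : Module.Finite k X.A := inferInstanceAs (Module.Finite k (Fin dA → k))
  have : Module.Finite k X.B := inferInstanceAs (Module.Finite k (Fin dB → k))
  exact ⟨X, μ.isAdmissible hn, ⟨μ⟩⟩

theorem exists_repMarking (hn : n ≤ 3) (M : QuiverRep Q R) :
    ∃ X : StableRep.{u'} Q k, X.IsAdmissible n ∧ Nonempty (RepMarking ϖ n ρ M X) := by
  choose X hX μ using fun i => hR.exists_marking hn (M.obj i)
  replace μ := fun i => (μ i).some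
  choose d γ hγ using fun i => hR.exists_isSubquotientMap ⊤ (freeKer ϖ n (M.inMap i))
    (fun x _ => mem_freeKer.2 ⟨0, by
      rw [map_zero, ← mul_smul, ← pow_succ, Nat.sub_add_cancel hR.pos, hR.pow_eq, zero_smul]⟩)
  have hA : ∀ {i j : Q} (a : i ⟶ j), ∃ l : (X i).A →ₗ[k] (X j).A,
      ∀ x ∈ powTorsion ϖ 1 (M.obj i), l ((μ i).α x) = (μ j).α (M.map a x) := fun {i j} a =>
    (μ i).hα.exists_factor hR.surj
      ((μ j).hα.toIsSemilinearOn.comp (M.map a) fun x hx => map_mem_powTorsion _ hx)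
      fun x hx hW => ((μ j).hα.ker _ (map_mem_powTorsion _ hx)).2 (map_mem_powMultiples _ hW)
  have hB : ∀ {i j : Q} (a : i ⟶ j), ∃ l : (X i).B →ₗ[k] (X j).B,
      ∀ x ∈ powTorsion ϖ 2 (M.obj i), l ((μ i).β x) = (μ j).β (M.map a x) := fun {i j} a =>
    (μ i).hβ.exists_factor hR.surj
      ((μ j).hβ.toIsSemilinearOn.comp (M.map a) fun x hx => map_mem_powTorsion _ hx)
      fun x hx hW => ((μ j).hβ.ker _ (map_mem_powTorsion _ hx)).2 (map_mem_powMultiples _ hW)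
  choose mA hmA using @hA
  choose mB hmB using @hB
  refine ⟨⟨X, fun i => Fin (d i) → k, mA, mB, fun {i j} a x => ?_, fun {i j} a y => ?_⟩,
    ⟨hX, fun i => (inferInstance : Module.Finite k (Fin (d i) → k))⟩,
    ⟨⟨μ, γ, hγ, fun a x hx => (hmA a x hx).symm, fun a x hx => (hmB a x hx).symm⟩⟩⟩
  · obtain ⟨m, hm, rfl⟩ := (μ i).hα.surj x
    rw [hmA a m hm, (μ i).ι_α m hm, hmB a m (powTorsion_mono (by omega) hm),
      (μ j).ι_α _ (map_mem_powTorsion _ hm)]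
  · obtain ⟨m, hm, rfl⟩ := (μ i).hβ.surj y
    have hm' : ϖ • m ∈ powTorsion ϖ 1 (M.obj i) := by
      rw [mem_powTorsion, ← mul_smul, pow_one, ← pow_two]; exact hm
    rw [hmB a m hm, (μ i).p_β m hm, hmA a _ hm', (μ j).p_β _ (map_mem_powTorsion _ hm), map_smul]

end IsChainRing

/-- A module with a marking. -/
structure MarkedModule {R : Type u} [CommRing R] {k : Type u'} [Field k] (ϖ : R) (n : ℕ)
    (ρ : R →+* k) (X : StableObj.{v} k) where
  carrier : Type u
  [addCommGroup : AddCommGroup carrier]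
  [module : Module R carrier]
  [finite : Module.Finite R carrier]
  mark : Marking ϖ n ρ carrier X

attribute [instance] MarkedModule.addCommGroup MarkedModule.module MarkedModule.finite

/-- Every admissible system of stable invariants is realized in the monomorphism category. -/
theorem IsChainRing.exists_isMono_repMarking {R : Type u} [CommRing R] [IsLocalRing R]
    {k : Type u'} [Field k] {ϖ : R} {n : ℕ} {ρ : R →+* k} (hR : IsChainRing R ϖ n ρ)
    {Q : Type w} [Quiver.{w'} Q] [Fintype Q] [∀ i j : Q, Fintype (i ⟶ j)] (hn : n ≤ 3)
    (hQ : Quiver.IsAcyclic Q) (X : StableRep.{v} Q k) (hX : X.IsAdmissible n) :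
    ∃ M : QuiverRep Q R, M.IsMono ∧ Nonempty (RepMarking ϖ n ρ M X) := by
  classical
  obtain ⟨t, ht⟩ := hQ.exists_rec (T := fun i => MarkedModule ϖ n ρ (X.obj i))
    (fun i f t => ∃ (l : (∀ a : (Σ j : Q, (j ⟶ i)), (f a).carrier) →ₗ[R] t.carrier)
      (γ : t.carrier → X.Z i), Function.Injective l ∧ IsSubquotientMap ρ ⊤ (freeKer ϖ n l) γ ∧
      (∀ a, ∀ x ∈ powTorsion ϖ 1 (f a).carrier,
        t.mark.α (l (LinearMap.single R _ a x)) = X.mapA a.2 ((f a).mark.α x)) ∧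
      ∀ a, ∀ x ∈ powTorsion ϖ 2 (f a).carrier,
        t.mark.β (l (LinearMap.single R _ a x)) = X.mapB a.2 ((f a).mark.β x)) (by
    intro i f
    have := hX.finite_Z i
    obtain ⟨N, _, _, _, ν, hN⟩ := hR.exists_realization hn (hX.obj i)
    choose h hA hB using fun a => hR.exists_lift hn (f a).mark ν (X.mapA a.2) (X.mapB a.2)
      (X.mapB_ι a.2) (X.mapA_p a.2)
    obtain ⟨M, _, _, _, μ, l, γ, h1, h2, h3, h4⟩ := hR.exists_vertex ν hN
      -- Each stable arrow map is lifted to the realization `N`; the sum of the lifts becomes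
      -- injective once free summands are added to `N`.
      (LinearMap.lsum R (fun a => (f a).carrier) R h) (X.Z i)
    refine ⟨⟨M, μ⟩, l, γ, h1, h2, fun a x hx => ?_, fun a x hx => ?_⟩
    · rw [h3 _ (map_mem_powTorsion _ hx), ← hA a x hx]
      exact congrArg ν.α (LinearMap.lsum_piSingle R _ R h a x)
    · rw [h4 _ (map_mem_powTorsion _ hx), ← hB a x hx]
      exact congrArg ν.β (LinearMap.lsum_piSingle R _ R h a x))
  choose l γ h1 h2 h3 h4 using ht
  let M : QuiverRep Q R :=
    { obj := fun i => (t i).carrier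
      map := fun {i j} a => l j ∘ₗ LinearMap.single R
        (fun b : (Σ i : Q, (i ⟶ j)) => (t b.1).carrier) ⟨i, a⟩ }
  have hM : ∀ i, M.inMap i = l i := fun i => by
    refine LinearMap.ext fun y => ?_
    rw [QuiverRep.inMap_apply]
    change ∑ a, l i (LinearMap.single R (fun b : (Σ j : Q, (j ⟶ i)) => (t b.1).carrier) a (y a)) = _
    rw [← map_sum]
    congr 1
    exact LinearMap.sum_single_apply _ y
  refine ⟨M, fun i => by rw [hM]; exact h1 i,
    ⟨⟨fun i => (t i).mark, γ, fun i => by rw [hM]; exact h2 i, ?_, ?_⟩⟩⟩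
  · exact fun {i j} a x hx => h3 j ⟨i, a⟩ x hx
  · exact fun {i j} a x hx => h4 j ⟨i, a⟩ x hx

/-! ### Dimensions of subquotients -/

section Dimension

variable {R : Type u} [CommRing R] {k : Type u'} [Field k] {ρ : R →+* k}
  {M : Type*} [AddCommGroup M] [Module R M]

/-- The subquotient `V / W` is a vector space of dimension `d`. -/
def HasDim (ρ : R →+* k) (V W : Submodule R M) (d : ℕ) : Prop :=
  ∃ f : M → (Fin d → k), IsSubquotientMap ρ V W f

theorem IsSubquotientMap.hasDim {A : Type*} [AddCommGroup A] [Module k A] [Module.Finite k A]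
    {V W : Submodule R M} {f : M → A} (hf : IsSubquotientMap ρ V W f) :
    HasDim ρ V W (Module.finrank k A) :=
  ⟨_, hf.comp_equiv (Module.finBasis k A).equivFun⟩

theorem HasDim.unique (hρ : Function.Surjective ρ) {V W : Submodule R M} {d e : ℕ}
    (hd : HasDim ρ V W d) (he : HasDim ρ V W e) : d = e := by
  obtain ⟨f, hf⟩ := hd
  obtain ⟨g, hg⟩ := he
  obtain ⟨l, -⟩ := hf.exists_equiv hρ hg
  simpa using l.finrank_eq

theorem HasDim.eq_add (hρ : Function.Surjective ρ) {U V W : Submodule R M} (hWV : W ≤ V)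
    (hVU : V ≤ U) {a b c : ℕ} (hc : HasDim ρ U W c) (ha : HasDim ρ V W a) (hb : HasDim ρ U V b) :
    c = a + b := by
  obtain ⟨f, hf⟩ := ha
  obtain ⟨g, hg⟩ := hb
  obtain ⟨h, hh⟩ := hc
  obtain ⟨l, hl⟩ := hf.exists_factor hρ (hh.toIsSemilinearOn.mono hVU) fun x hx hW =>
    (hh.ker x (hVU hx)).2 hW
  obtain ⟨m, hm⟩ := hh.exists_factor hρ hg.toIsSemilinearOn fun x hx hW =>
    (hg.ker x hx).2 (hWV hW)
  have hl0 : Function.Injective l := by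
    rw [injective_iff_map_eq_zero]
    intro y hy
    obtain ⟨x, hx, rfl⟩ := hf.surj y
    rw [hl x hx, hh.ker x (hVU hx)] at hy
    exact (hf.ker x hx).2 hy
  have hm0 : LinearMap.range m = ⊤ := by
    rw [LinearMap.range_eq_top]
    intro y
    obtain ⟨x, hx, rfl⟩ := hg.surj y
    exact ⟨h x, hm x hx⟩
  have hlm : LinearMap.ker m = LinearMap.range l := by
    ext y
    constructor
    · intro hy
      obtain ⟨x, hx, rfl⟩ := hh.surj y
      rw [LinearMap.mem_ker, hm x hx, hg.ker x hx] at hy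
      exact ⟨f x, hl x hy⟩
    · rintro ⟨y, rfl⟩
      obtain ⟨x, hx, rfl⟩ := hf.surj y
      rw [LinearMap.mem_ker, hl x hx, hm x (hVU hx), hg.ker x (hVU hx)]
      exact hx
  have h1 := LinearMap.finrank_range_add_finrank_ker m
  rw [hm0, hlm, LinearMap.finrank_range_of_inj hl0, finrank_top] at h1
  simp only [Module.finrank_fin_fun] at h1
  omega

end Dimension

namespace IsChainRing

variable {R : Type u} [CommRing R] [IsLocalRing R] {k : Type u'} [Field k]
  {ϖ : R} {n : ℕ} {ρ : R →+* k} (hR : IsChainRing R ϖ n ρ)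

include hR

theorem powMultiples_le_powTorsion (M : Type*) [AddCommGroup M] [Module R M] :
    powMultiples ϖ (n - 1) M ≤ powTorsion ϖ 1 M := by
  rintro x ⟨z, rfl⟩
  rw [mem_powTorsion, LinearMap.lsmul_apply, ← mul_smul, ← pow_add,
    hR.pow_eq_zero_of_le (by have := hR.pos; omega), zero_smul]

theorem exists_hasDim_powMultiples (M : Type*) [AddCommGroup M] [Module R M]
    [Module.Finite R M] : ∃ d, HasDim ρ (powMultiples ϖ (n - 1) M) ⊥ d := by
  obtain ⟨d, f, hf⟩ := hR.exists_isSubquotientMap (powMultiples ϖ (n - 1) M) ⊥ (fun x hx => by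
    have := mem_powTorsion.1 (hR.powMultiples_le_powTorsion M hx)
    rw [pow_one] at this
    rw [this]; exact Submodule.zero_mem _)
  exact ⟨d, f, hf⟩

variable {Q : Type w} [Quiver.{w'} Q] [Fintype Q] [∀ i j : Q, Fintype (i ⟶ j)]

/-- The recursion for the ranks of the maximal free summands of the modules in a representation in
the monomorphism category. -/
theorem hasDim_powMultiples_eq {M : QuiverRep Q R} (hM : M.IsMono)
    {X : StableRep.{v} Q k} (hX : X.IsAdmissible n) (μ : RepMarking ϖ n ρ M X) {d : Q → ℕ}
    (hd : ∀ i, HasDim ρ (powMultiples ϖ (n - 1) (M.obj i)) ⊥ (d i)) (i : Q) :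
    d i = ∑ a : (Σ j : Q, (j ⟶ i)), d a.1 +
      Module.finrank k (LinearMap.ker (∑ a : (Σ j : Q, (j ⟶ i)),
        (X.mapA a.2).comp (LinearMap.proj (φ := fun a : (Σ j : Q, (j ⟶ i)) => (X.obj a.1).A) a))) +
      Module.finrank k (X.Z i) := by
  classical
  have := hR.noeth
  have := hX.finite_Z i
  have := fun j => (hX.obj j).finite_A
  set L : (∀ a : (Σ j : Q, (j ⟶ i)), (X.obj a.1).A) →ₗ[k] (X.obj i).A :=
    ∑ a : (Σ j : Q, (j ⟶ i)), (X.mapA a.2).comp (LinearMap.proj a) with hLdef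
  have hL : ∀ z, L z = ∑ a, X.mapA a.2 (z a) := fun z => by simp [hLdef, LinearMap.sum_apply]
  let P := ∀ a : (Σ j : Q, (j ⟶ i)), M.obj a.1
  let D := powMultiples ϖ (n - 1) (M.obj i)
  -- The three terms of the recursion are the layers of `0 ≤ inMap(ϖ^(n-1) P) ≤ inMap(K) ≤ D`: the
  -- free ranks at the sources, the kernel of the sum of the incoming maps on `A`, and `Z i`.
  let K : Submodule R P := D.comap (M.inMap i)
  have hK1 : K ≤ powTorsion ϖ 1 P := fun y hy => by
    have h1 := mem_powTorsion.1 (hR.powMultiples_le_powTorsion _ hy)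
    rw [mem_powTorsion]
    exact hM i (by rw [map_smul, h1, map_zero])
  have hPK : powMultiples ϖ (n - 1) P ≤ K := fun y hy => map_mem_powMultiples (M.inMap i) hy
  -- the quotient of `D` by the image of `K`
  obtain ⟨f₁, hf₁, -⟩ := exists_isSubquotientMap_of_param (ρ := ρ) (V := D)
    (W := K.map (M.inMap i)) (LinearMap.lsmul R (M.obj i) (ϖ ^ (n - 1)))
    (⟨⟨μ.γ i, fun x y => (μ.hγ i).add x trivial y trivial⟩,
      fun r x => (μ.hγ i).smul r x trivial⟩ : M.obj i →ₛₗ[ρ] X.Z i)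
    (fun z => by
      obtain ⟨x, -, hx⟩ := (μ.hγ i).surj z
      exact ⟨x, hx⟩)
    (fun x => Iff.rfl) (fun x => by
      refine Iff.trans ?_ ((μ.hγ i).ker x trivial).symm
      rw [mem_freeKer]
      constructor
      · rintro ⟨y, -, hy⟩
        exact ⟨y, hy⟩
      · rintro ⟨y, hy⟩
        exact ⟨y, by change M.inMap i y ∈ D; rw [hy]; exact ⟨x, rfl⟩, hy⟩)
  -- the image of `K`
  obtain ⟨e, g, hg⟩ := hR.exists_isSubquotientMap K ⊥ (fun y hy => by
    have := mem_powTorsion.1 (hK1 hy)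
    rw [pow_one] at this
    rw [this]; exact Submodule.zero_mem _)
  obtain ⟨f₂, hf₂, -⟩ := exists_isSubquotientMap_of_param (ρ := ρ)
    (V := K.map (M.inMap i)) (W := ⊥) ((M.inMap i).comp K.subtype)
    (⟨⟨fun y => g y, fun x y => hg.add x x.2 y y.2⟩,
      fun r x => hg.smul r x x.2⟩ : K →ₛₗ[ρ] (Fin e → k))
    (fun z => by
      obtain ⟨x, hx, h⟩ := hg.surj z
      exact ⟨⟨x, hx⟩, h⟩)
    (fun x => by
      constructor
      · rintro ⟨y, hy, h⟩
        exact ⟨⟨y, hy⟩, h⟩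
      · rintro ⟨y, h⟩
        exact ⟨y, y.2, h⟩)
    (fun y => by
      refine Iff.trans ?_ (hg.ker y y.2).symm
      rw [Submodule.mem_bot, Submodule.mem_bot, LinearMap.comp_apply]
      exact map_eq_zero_iff (M.inMap i) (hM i))
  -- the quotient of `K` by the multiples of `ϖ ^ (n - 1)`
  have hmem : ∀ y : P, y ∈ powMultiples ϖ (n - 1) P ↔
      ∀ a, y a ∈ powMultiples ϖ (n - 1) (M.obj a.1) := fun y => by
    constructor
    · intro hy a
      exact map_mem_powMultiples (LinearMap.proj a) hy
    · intro h
      choose z hz using h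
      exact ⟨z, funext hz⟩
  have hKtor : ∀ (y : K) a, (y : P) a ∈ powTorsion ϖ 1 (M.obj a.1) := fun y a =>
    proj_mem_powTorsion (hK1 y.2) a
  obtain ⟨f₃, hf₃, -⟩ := exists_isSubquotientMap_of_param (ρ := ρ)
    (V := K) (W := powMultiples ϖ (n - 1) P) K.subtype
    (⟨⟨fun y => ⟨fun a => (μ.mark a.1).α ((y : P) a), by
        rw [LinearMap.mem_ker, hL, ← μ.α_inMap i _ (hKtor y),
          (μ.mark i).hα.ker _ (hR.powMultiples_le_powTorsion _ y.2)]
        exact y.2⟩,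
        fun x y => Subtype.ext (funext fun a =>
          (μ.mark a.1).hα.add _ (hKtor x a) _ (hKtor y a))⟩,
      fun r x => Subtype.ext (funext fun a => (μ.mark a.1).hα.smul r _ (hKtor x a))⟩ :
        K →ₛₗ[ρ] LinearMap.ker L)
    (fun z => by
      choose y hy hyz using fun a => (μ.mark a.1).hα.surj (z.1 a)
      have h1 : M.inMap i y ∈ powTorsion ϖ 1 (M.obj i) := by
        rw [QuiverRep.inMap_apply]
        exact Submodule.sum_mem _ fun a _ => map_mem_powTorsion _ (hy a)
      have h2 : y ∈ K := by
        change M.inMap i y ∈ D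
        rw [← (μ.mark i).hα.ker _ h1, μ.α_inMap i y hy]
        simp_rw [hyz]
        rw [← hL]
        exact z.2
      exact ⟨⟨y, h2⟩, Subtype.ext (funext hyz)⟩)
    (fun y => ⟨fun hy => ⟨⟨y, hy⟩, rfl⟩, fun ⟨z, hz⟩ => hz ▸ z.2⟩)
    (fun y => by
      rw [hmem, ← Subtype.coe_inj]
      refine Iff.trans ?_ funext_iff.symm
      exact forall_congr' fun a => ((μ.mark a.1).hα.ker _ (hKtor y a)).symm)
  -- the multiples of `ϖ ^ (n - 1)`
  choose φ hφ using hd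
  have hf₄ : IsSubquotientMap ρ (powMultiples ϖ (n - 1) P) ⊥
      (fun (y : P) (a : (Σ j : Q, (j ⟶ i))) => φ a.1 (y a)) :=
    { add := fun x hx y hy => funext fun a =>
        (hφ a.1).add _ ((hmem x).1 hx a) _ ((hmem y).1 hy a)
      smul := fun r x hx => funext fun a => (hφ a.1).smul _ _ ((hmem x).1 hx a)
      surj := fun z => by
        choose y hy hyz using fun a : (Σ j : Q, (j ⟶ i)) => (hφ a.1).surj (z a)
        exact ⟨y, (hmem y).2 hy, funext hyz⟩
      ker := fun y hy => by
        rw [Submodule.mem_bot, funext_iff, funext_iff]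
        exact forall_congr' fun a =>
          ((hφ a.1).ker _ ((hmem y).1 hy a)).trans (Submodule.mem_bot R) }
  have h4 := hf₄.hasDim
  rw [Module.finrank_pi_fintype] at h4
  simp only [Module.finrank_fin_fun] at h4
  have e1 := HasDim.eq_add hR.surj bot_le hPK ⟨g, hg⟩ h4 hf₃.hasDim
  have e2 := HasDim.eq_add hR.surj bot_le
    (by rintro _ ⟨y, hy, rfl⟩; exact hy) ⟨φ i, hφ i⟩ ⟨f₂, hf₂⟩ hf₁.hasDim
  rw [e2, e1]

end IsChainRing

theorem hasDim_powMultiples_congr {R : Type u} [CommRing R] [IsLocalRing R] {S : Type v}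
    [CommRing S] [IsLocalRing S] {k : Type u'} [Field k] {ϖ : R} {ϖ' : S} {n : ℕ} {ρ : R →+* k}
    {ρ' : S →+* k} (hR : IsChainRing R ϖ n ρ) (hS : IsChainRing S ϖ' n ρ')
    {Q : Type w} [Quiver.{w'} Q] [Fintype Q] [∀ i j : Q, Fintype (i ⟶ j)]
    (hQ : Quiver.IsAcyclic Q) {M : QuiverRep Q R} (hM : M.IsMono) {N : QuiverRep Q S}
    (hN : N.IsMono) {X : StableRep.{v'} Q k} (hX : X.IsAdmissible n) (μ : RepMarking ϖ n ρ M X)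
    (ν : RepMarking ϖ' n ρ' N X) (i : Q) :
    ∃ d, HasDim ρ (powMultiples ϖ (n - 1) (M.obj i)) ⊥ d ∧
      HasDim ρ' (powMultiples ϖ' (n - 1) (N.obj i)) ⊥ d := by
  choose d hd using fun i => hR.exists_hasDim_powMultiples (M.obj i)
  choose e he using fun i => hS.exists_hasDim_powMultiples (N.obj i)
  have h : ∀ i, d i = e i := fun i => by
    induction i using hQ.wellFounded.induction with
    | _ i ih =>
      rw [hR.hasDim_powMultiples_eq hM hX μ hd i, hS.hasDim_powMultiples_eq hN hX ν he i]
      congr 2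
      exact Finset.sum_congr rfl fun a _ => ih a.1 ⟨a.2⟩
  exact ⟨d i, hd i, h i ▸ he i⟩

/-! ### Partitions -/

section Count

theorem List.countP_le_eq_add_count (α : List ℕ) (b : ℕ) :
    α.countP (fun a => b ≤ a) = α.countP (fun a => b + 1 ≤ a) + α.count b := by
  induction α with
  | nil => simp
  | cons a α ih =>
    simp only [List.countP_cons, List.count_cons, ih, decide_eq_true_eq, beq_iff_eq]
    split_ifs <;> omega

theorem List.eq_of_countP_le {α β : List ℕ} (hα : α.Pairwise (· ≥ ·)) (hβ : β.Pairwise (· ≥ ·))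
    (hα1 : ∀ a ∈ α, 1 ≤ a) (hβ1 : ∀ a ∈ β, 1 ≤ a)
    (h : ∀ b, 1 ≤ b → α.countP (fun a => b ≤ a) = β.countP (fun a => b ≤ a)) : α = β := by
  refine List.Perm.eq_of_pairwise' hα hβ (List.perm_iff_count.2 fun b => ?_)
  rcases Nat.eq_zero_or_pos b with rfl | hb
  · rw [List.count_eq_zero_of_not_mem fun h => absurd (hα1 0 h) (by omega),
      List.count_eq_zero_of_not_mem fun h => absurd (hβ1 0 h) (by omega)]
  · have h1 := α.countP_le_eq_add_count b
    have h2 := β.countP_le_eq_add_count b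
    have h3 := h b hb
    have h4 := h (b + 1) (by omega)
    omega

theorem List.card_subtype_get_le (α : List ℕ) (b : ℕ) :
    Fintype.card {j : Fin α.length // b ≤ α.get j} = α.countP (fun a => b ≤ a) := by
  rw [Fintype.card_subtype, Finset.card_filter]
  induction α with
  | nil => simp
  | cons a α ih =>
    rw [List.countP_cons, ← ih]
    refine (Fin.sum_univ_succ (n := α.length) _).trans ?_
    by_cases h : b ≤ a <;> simp [h, add_comm]

end Count

namespace IsChainRing

variable {R : Type u} [CommRing R] [IsLocalRing R] {k : Type u'} [Field k]
  {ϖ : R} {n : ℕ} {ρ : R →+* k} (hR : IsChainRing R ϖ n ρ)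

include hR

/-- This quotient of `M` is `ϖ^(b-1)M / ϖ^b M`, to which each cyclic summand of exponent `≥ b`
contributes one dimension and the others none. -/
theorem hasDim_countP {M : Type*} [AddCommGroup M] [Module R M] {α : List ℕ}
    (hα : HasPartition R M α) {b : ℕ} (hb : 1 ≤ b) :
    HasDim ρ ⊤ ((powMultiples ϖ b M).comap (LinearMap.lsmul R M (ϖ ^ (b - 1))))
      (α.countP (fun a => b ≤ a)) := by
  obtain ⟨e, he, ha⟩ := hR.exists_isCyclicBasis_of_hasPartition hα
  obtain ⟨f, hf, -⟩ := exists_isSubquotientMap_of_param (ρ := ρ) (V := (⊤ : Submodule R M))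
    (W := (powMultiples ϖ b M).comap (LinearMap.lsmul R M (ϖ ^ (b - 1))))
    (Fintype.linearCombination R e)
    (⟨⟨fun r j => ρ (r j.1), fun r s => by funext j; simp⟩, fun c r => by funext j; simp⟩ :
      (Fin α.length → R) →ₛₗ[ρ] ({j : Fin α.length // b ≤ α.get j} → k))
    (fun z => by
      classical
      choose r hr using fun j => hR.surj (z j)
      refine ⟨fun j => if h : b ≤ α.get j then r ⟨j, h⟩ else 0, ?_⟩
      funext j
      simp only [LinearMap.coe_mk, AddHom.coe_mk]
      rw [dif_pos j.2, hr])
    (fun x => ⟨fun _ => by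
      obtain ⟨r, hr⟩ := he.exists_sum x
      exact ⟨r, by rw [hr, Fintype.linearCombination_apply]⟩, fun _ => trivial⟩)
    (fun r => by
      have h1 : (⟨⟨fun r j => ρ (r j.1), fun r s => by funext j; simp⟩,
          fun c r => by funext j; simp⟩ : (Fin α.length → R) →ₛₗ[ρ]
            ({j : Fin α.length // b ≤ α.get j} → k)) r = 0 ↔ ∀ j, b ≤ α.get j → ϖ ∣ r j := by
        rw [funext_iff, Subtype.forall]
        exact forall_congr' fun j => forall_congr' fun _ => hR.rho_eq_zero _
      rw [h1, Submodule.mem_comap, LinearMap.lsmul_apply, Fintype.linearCombination_apply]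
      constructor
      · rintro ⟨z, hz⟩ j hj
        obtain ⟨s, rfl⟩ := he.exists_sum z
        have h2 : ∑ j, (ϖ ^ (b - 1) * r j - ϖ ^ b * s j) • e j = 0 := by
          simp_rw [sub_smul, mul_smul]
          rw [Finset.sum_sub_distrib, ← Finset.smul_sum, ← Finset.smul_sum, ← hz,
            LinearMap.lsmul_apply, sub_self]
        have h3 := (pow_dvd_pow ϖ hj).trans (he.dvd_of_sum _ h2 j)
        have h4 : ϖ ^ b ∣ ϖ ^ (b - 1) * r j := (dvd_sub_left (dvd_mul_right _ _)).1 h3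
        have h5 := hR.pow_dvd_of_dvd_mul (hj.trans (ha j).2) h4
        rwa [show b - (b - 1) = 1 by omega, pow_one] at h5
      · intro h
        rw [Finset.smul_sum]
        refine Submodule.sum_mem _ fun j _ => ?_
        by_cases hj : b ≤ α.get j
        · obtain ⟨s, hs⟩ := h j hj
          refine ⟨s • e j, ?_⟩
          rw [LinearMap.lsmul_apply, hs, mul_smul, ← mul_smul _ ϖ, ← pow_succ,
            Nat.sub_add_cancel hb]
        · have h2 : ϖ ^ (b - 1) • r j • e j = 0 := by
            rw [smul_comm, show b - 1 = (b - 1 - α.get j) + α.get j by omega, pow_add, mul_smul,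
              he.pow_smul, smul_zero, smul_zero]
          rw [h2]; exact Submodule.zero_mem _)
  have h := hf.hasDim
  rwa [Module.finrank_fintype_fun_eq_card, List.card_subtype_get_le] at h

theorem hasPartition_unique {M : Type*} [AddCommGroup M] [Module R M] {α β : List ℕ}
    (hα : HasPartition R M α) (hβ : HasPartition R M β) : α = β :=
  List.eq_of_countP_le hα.1 hβ.1 (fun a ha => (hα.2.1 a ha).1) (fun a ha => (hβ.2.1 a ha).1)
    fun _ hb => (hR.hasDim_countP hα hb).unique hR.surj (hR.hasDim_countP hβ hb)

/-- The number of parts `≥ b` of the partition of a module is determined by its stable invariants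
and the rank `d` of its maximal free summands. -/
theorem countP_eq (hn : n ≤ 3) {M : Type*} [AddCommGroup M] [Module R M] {X : StableObj.{v} k}
    (hX : X.IsAdmissible n) (μ : Marking ϖ n ρ M X) {d : ℕ}
    (hd : HasDim ρ (powMultiples ϖ (n - 1) M) ⊥ d) {α : List ℕ} (hα : HasPartition R M α) {b : ℕ}
    (hb : 1 ≤ b) :
    α.countP (fun a => b ≤ a) =
      if n < b then 0 else if b = n then d
        else if b = 2 then Module.finrank k (LinearMap.range X.p) + d
        else if n = 2 then Module.finrank k X.A + d else Module.finrank k X.B + d := by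
  have := hX.finite_A
  have := hX.finite_B
  obtain ⟨φ, hφ⟩ := hd
  have hmul : ∀ x : M, ϖ ^ (n - 1) • x ∈ powMultiples ϖ (n - 1) M := fun x => ⟨x, rfl⟩
  -- Multiplication by `ϖ^(n-1)` identifies `M/M[ϖ^(n-1)]` with `ϖ^(n-1)M`. For `b < n` this is the
  -- top layer in the filtration through `M[ϖ^(n-1)]`, and the lower layer is read off from the
  -- invariants.
  have hF : HasDim ρ ⊤ (powTorsion ϖ (n - 1) M) d :=
    ⟨fun x => φ (ϖ ^ (n - 1) • x),
      { toIsSemilinearOn := hφ.toIsSemilinearOn.comp (U := ⊤) (LinearMap.lsmul R M (ϖ ^ (n - 1)))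
          fun x _ => hmul x
        surj := fun z => by
          obtain ⟨_, ⟨x, rfl⟩, hx⟩ := hφ.surj z
          exact ⟨x, trivial, hx⟩
        ker := fun x _ => by rw [hφ.ker _ (hmul x), Submodule.mem_bot]; rfl }⟩
  have hc := hR.hasDim_countP hα hb
  have hpos := hR.pos
  have htor : ∀ x : M, ϖ ^ n • x = 0 := fun x => by rw [hR.pow_eq, zero_smul]
  split_ifs with h1 h2 h3 h4
  · rw [List.countP_eq_zero]
    intro a ha
    have := (hα.2.1 a ha).2
    rw [hR.loewy] at this
    simp only [decide_eq_true_eq]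
    omega
  · subst h2
    refine hc.unique hR.surj ?_
    have : (powMultiples ϖ b M).comap (LinearMap.lsmul R M (ϖ ^ (b - 1))) =
        powTorsion ϖ (b - 1) M := by
      ext x
      constructor
      · rintro ⟨z, hz⟩
        rw [mem_powTorsion]
        rw [LinearMap.lsmul_apply, htor, LinearMap.lsmul_apply] at hz
        exact hz.symm
      · intro hx
        rw [Submodule.mem_comap, LinearMap.lsmul_apply, mem_powTorsion.1 hx]
        exact Submodule.zero_mem _
    rwa [this]
  · have hn3 : n = 3 := by omega
    subst h3
    subst hn3
    have hβ := μ.hβ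
    simp only [Nat.add_one_sub_one, Nat.reduceSub, pow_one] at hF hc hβ
    have h21 : ∀ x : M, x ∈ powTorsion ϖ 2 M → ϖ • x ∈ powTorsion ϖ 1 M := fun x hx => by
      rw [mem_powTorsion, ← mul_smul, pow_one, ← pow_two]; exact hx
    refine hc.eq_add hR.surj (V := powTorsion ϖ 2 M) ?_ le_top ?_ hF
    · rintro x ⟨z, hz⟩
      rw [mem_powTorsion, pow_two, mul_smul]
      simp only [LinearMap.lsmul_apply] at hz
      rw [← hz, ← mul_smul, ← pow_succ', htor]
    -- For `x ∈ M[ϖ²]`, `p (β x)` is the class of `ϖ x`, which vanishes exactly when `ϖ x ∈ ϖ² M`.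
    · refine IsSubquotientMap.hasDim (f := fun x => X.p.rangeRestrict (μ.β x)) ?_
      refine { toIsSemilinearOn := hβ.toIsSemilinearOn.linear_comp X.p.rangeRestrict, surj := ?_,
               ker := ?_ }
      · rintro ⟨_, y, rfl⟩
        obtain ⟨x, hx, rfl⟩ := hβ.surj y
        exact ⟨x, hx, rfl⟩
      · intro x hx
        have h5 : X.p.rangeRestrict (μ.β x) = 0 ↔ X.p (μ.β x) = 0 := Subtype.ext_iff
        rw [h5, μ.p_β x hx, μ.hα.ker _ (h21 x hx)]
        rfl
  · have hb1 : b = 1 := by omega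
    subst hb1
    subst h4
    have hα' := μ.hα
    simp only [Nat.add_one_sub_one, Nat.sub_self, pow_zero] at hF hc hα'
    have hW : (powMultiples ϖ 1 M).comap (LinearMap.lsmul R M (1 : R)) = powMultiples ϖ 1 M := by
      ext x; simp
    rw [hW] at hc
    exact hc.eq_add hR.surj (V := powTorsion ϖ 1 M) (hR.powMultiples_le_powTorsion M) le_top
      hα'.hasDim hF
  · have hb1 : b = 1 := by omega
    have hn3 : n = 3 := by omega
    subst hb1
    subst hn3
    have hβ := μ.hβ
    simp only [Nat.add_one_sub_one, Nat.reduceSub, Nat.sub_self, pow_zero] at hF hc hβ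
    have hW : (powMultiples ϖ 1 M).comap (LinearMap.lsmul R M (1 : R)) = powMultiples ϖ 1 M := by
      ext x; simp
    rw [hW] at hc
    refine hc.eq_add hR.surj (V := powTorsion ϖ 2 M) ?_ le_top hβ.hasDim hF
    rintro x ⟨z, rfl⟩
    rw [mem_powTorsion, LinearMap.lsmul_apply, ← mul_smul, ← pow_add, htor]

end IsChainRing

section Partition

variable {R : Type u} [CommRing R] [IsLocalRing R] {M N : Type*} [AddCommGroup M] [Module R M]
  [AddCommGroup N] [Module R N]

theorem HasPartition.of_linearEquiv {α : List ℕ} (h : HasPartition R M α) (e : N ≃ₗ[R] M) :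
    HasPartition R N α :=
  ⟨h.1, h.2.1, h.2.2.map e.trans⟩

theorem hasPartition_nil [Subsingleton M] : HasPartition R M [] := by
  refine ⟨List.Pairwise.nil, fun a ha => absurd ha List.not_mem_nil, ?_⟩
  have : Subsingleton (∀ k : Fin ([] : List ℕ).length,
      R ⧸ IsLocalRing.maximalIdeal R ^ ([] : List ℕ).get k) :=
    ⟨fun f g => funext fun k => k.elim0⟩
  exact ⟨⟨0, fun _ => 0, fun _ => Subsingleton.elim _ _, fun _ => Subsingleton.elim _ _⟩⟩

theorem HasPartition.subsingleton (h : HasPartition R M []) : Subsingleton M := by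
  obtain ⟨e⟩ := h.2.2
  exact ⟨fun x y => e.injective (funext fun k => k.elim0)⟩

end Partition

/-! ### Comparing representations over the two rings -/

theorem StableRep.IsAdmissible.directSum {Q : Type w} [Quiver.{w'} Q] {k : Type u'} [Field k]
    {n : ℕ} {X Y : StableRep.{v} Q k} (hX : X.IsAdmissible n) (hY : Y.IsAdmissible n) :
    (X.directSum Y).IsAdmissible n where
  obj i :=
    { finite_A := by
        have := (hX.obj i).finite_A
        have := (hY.obj i).finite_A
        exact inferInstanceAs (Module.Finite k ((X.obj i).A × (Y.obj i).A))
      finite_B := by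
        have := (hX.obj i).finite_B
        have := (hY.obj i).finite_B
        exact inferInstanceAs (Module.Finite k ((X.obj i).B × (Y.obj i).B))
      subsingleton_A := fun h => by
        have := (hX.obj i).subsingleton_A h
        have := (hY.obj i).subsingleton_A h
        exact inferInstanceAs (Subsingleton ((X.obj i).A × (Y.obj i).A))
      subsingleton_B := fun h => by
        have := (hX.obj i).subsingleton_B h
        have := (hY.obj i).subsingleton_B h
        exact inferInstanceAs (Subsingleton ((X.obj i).B × (Y.obj i).B))
      p_ι := fun a => Prod.ext ((hX.obj i).p_ι a.1) ((hY.obj i).p_ι a.2)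
      ι_p := fun b => Prod.ext ((hX.obj i).ι_p b.1) ((hY.obj i).ι_p b.2)
      exact_A := fun h a ha => by
        obtain ⟨b, hb⟩ := (hX.obj i).exact_A h a.1 (congrArg Prod.fst ha)
        obtain ⟨c, hc⟩ := (hY.obj i).exact_A h a.2 (congrArg Prod.snd ha)
        exact ⟨(b, c), Prod.ext hb hc⟩
      exact_B := fun h b hb => by
        obtain ⟨a, ha⟩ := (hX.obj i).exact_B h b.1 (congrArg Prod.fst hb)
        obtain ⟨c, hc⟩ := (hY.obj i).exact_B h b.2 (congrArg Prod.snd hb)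
        exact ⟨(a, c), Prod.ext ha hc⟩ }
  finite_Z i := by
    have := hX.finite_Z i
    have := hY.finite_Z i
    exact inferInstanceAs (Module.Finite k (X.Z i × Y.Z i))

/-- The representations `M` and `N`, over two rings with residue field `k`, have isomorphic stable
invariants. -/
def StablyAlike {Q : Type w} [Quiver.{w'} Q] [Fintype Q] [∀ i j : Q, Fintype (i ⟶ j)]
    {R : Type u} [CommRing R] {S : Type v} [CommRing S] {k : Type u'} [Field k] (n : ℕ) (ϖ : R)
    (ρ : R →+* k) (ϖ' : S) (ρ' : S →+* k) (M : QuiverRep Q R) (N : QuiverRep Q S) : Prop :=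
  ∃ X : StableRep.{u'} Q k, X.IsAdmissible n ∧ Nonempty (RepMarking ϖ n ρ M X) ∧
    Nonempty (RepMarking ϖ' n ρ' N X)

namespace StablyAlike

variable {Q : Type w} [Quiver.{w'} Q] [Fintype Q] [∀ i j : Q, Fintype (i ⟶ j)]
  {R : Type u} [CommRing R] {S : Type v} [CommRing S]
  {k : Type u'} [Field k] {n : ℕ} {ϖ : R} {ρ : R →+* k} {ϖ' : S} {ρ' : S →+* k}

theorem symm {M : QuiverRep Q R} {N : QuiverRep Q S} (h : StablyAlike n ϖ ρ ϖ' ρ' M N) :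
    StablyAlike n ϖ' ρ' ϖ ρ N M := by
  obtain ⟨X, hX, hμ, hν⟩ := h
  exact ⟨X, hX, hν, hμ⟩

variable [IsLocalRing R] [IsLocalRing S] (hn : n ≤ 3) (hQ : Quiver.IsAcyclic Q)
  (hR : IsChainRing R ϖ n ρ) (hS : IsChainRing S ϖ' n ρ')

include hn hQ hR hS

theorem exists_isMono (M : QuiverRep Q R) :
    ∃ N : QuiverRep Q S, N.IsMono ∧ StablyAlike n ϖ ρ ϖ' ρ' M N := by
  obtain ⟨X, hX, hμ⟩ := hR.exists_repMarking hn M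
  obtain ⟨N, hN, hν⟩ := hS.exists_isMono_repMarking hn hQ X hX
  exact ⟨N, hN, X, hX, hμ, hν⟩

/-- The two pairs may be marked by different systems `X` and `X'`. Two markings of one
representation differ by an isomorphism of systems, so the marking of `N` by `X` can be moved to
`X'`. -/
theorem nonempty_iso {M M' : QuiverRep Q R} {N N' : QuiverRep Q S} (hN : N.IsMono)
    (hN' : N'.IsMono) (h : StablyAlike n ϖ ρ ϖ' ρ' M N) (h' : StablyAlike n ϖ ρ ϖ' ρ' M' N')
    (e : Nonempty (M.Iso M')) : Nonempty (N.Iso N') := by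
  obtain ⟨X, hX, ⟨μ⟩, ⟨ν⟩⟩ := h
  obtain ⟨X', hX', ⟨μ'⟩, ⟨ν'⟩⟩ := h'
  obtain ⟨e⟩ := e
  obtain ⟨ν₁⟩ := RepMarking.transfer hR.surj μ (μ'.ofIso e) ν
  exact hS.nonempty_iso hn hQ hN hN' hX' ν₁ ν'

theorem hasPartition {M : QuiverRep Q R} {N : QuiverRep Q S} (hM : M.IsMono) (hN : N.IsMono)
    (h : StablyAlike n ϖ ρ ϖ' ρ' M N) {i : Q} {α : List ℕ}
    (hα : HasPartition R (M.obj i) α) : HasPartition S (N.obj i) α := by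
  obtain ⟨X, hX, ⟨μ⟩, ⟨ν⟩⟩ := h
  obtain ⟨β, hβ⟩ := hS.exists_hasPartition (N.obj i)
  obtain ⟨d, hd, hd'⟩ := hasDim_powMultiples_congr hR hS hQ hM hN hX μ ν i
  have : α = β := List.eq_of_countP_le hα.1 hβ.1 (fun a ha => (hα.2.1 a ha).1)
    (fun a ha => (hβ.2.1 a ha).1) fun b hb => by
      rw [hR.countP_eq hn (hX.obj i) (μ.mark i) hd hα hb,
        hS.countP_eq hn (hX.obj i) (ν.mark i) hd' hβ hb]
  rwa [this]

theorem isZero {M : QuiverRep Q R} {N : QuiverRep Q S} (hM : M.IsMono) (hN : N.IsMono)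
    (h : StablyAlike n ϖ ρ ϖ' ρ' M N) (h0 : M.IsZero) : N.IsZero := fun i =>
  have := h0 i
  (h.hasPartition hn hQ hR hS hM hN (i := i) hasPartition_nil).subsingleton

/-- A decomposition of `N` is carried back summand by summand; by completeness of the invariants the
resulting sum is isomorphic to `M`, so one summand is zero, and zero objects correspond. -/
theorem isIndecomposableMono {M : QuiverRep Q R} {N : QuiverRep Q S}
    (hM : M.IsIndecomposableMono) (hN : N.IsMono) (h : StablyAlike n ϖ ρ ϖ' ρ' M N) :
    N.IsIndecomposableMono := by
  refine ⟨hN, fun h0 => hM.2.1 (h.symm.isZero hn hQ hS hR hN hM.1 h0), fun C D hC hD e => ?_⟩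
  obtain ⟨A, hA, hCA⟩ := exists_isMono hn hQ hS hR C
  obtain ⟨B, hB, hDB⟩ := exists_isMono hn hQ hS hR D
  have hsum : StablyAlike n ϖ' ρ' ϖ ρ (C.directSum D) (A.directSum B) := by
    obtain ⟨X, hX, ⟨μ⟩, ⟨ν⟩⟩ := hCA
    obtain ⟨Y, hY, ⟨μ'⟩, ⟨ν'⟩⟩ := hDB
    exact ⟨X.directSum Y, hX.directSum hY, ⟨μ.directSum μ'⟩, ⟨ν.directSum ν'⟩⟩
  exact (hM.2.2 A B hA hB
    (nonempty_iso hn hQ hS hR hM.1 (hA.directSum hB) h.symm hsum e)).imp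
    (hCA.symm.isZero hn hQ hR hS hA hC) (hDB.symm.isZero hn hQ hR hS hB hD)

end StablyAlike

theorem QuiverRep.IndecMono.hasPartitionVector_mk {Q : Type w} [Quiver.{w'} Q] [Fintype Q]
    [∀ i j : Q, Fintype (i ⟶ j)] {R : Type u} [CommRing R] [IsLocalRing R]
    (M : {M : QuiverRep Q R // M.IsIndecomposableMono}) (α : Q → List ℕ) :
    IndecMono.HasPartitionVector (Quotient.mk (indecMonoSetoid Q R) M : IndecMono Q R) α ↔
      ∀ i, HasPartition R (M.1.obj i) (α i) := by
  refine ⟨?_, fun h => ⟨M, rfl, h⟩⟩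
  rintro ⟨N, hN, h⟩ i
  obtain ⟨e⟩ : Nonempty (N.1.Iso M.1) := Quotient.exact hN
  exact (h i).of_linearEquiv (e.equiv i).symm

theorem mainTheorem4 {Λ : Type u} {Γ : Type v} [CommRing Λ] [CommRing Γ]
    [IsLocalRing Λ] [IsLocalRing Γ]
    (hΛ : IsUniserialRing Λ) (hΓ : IsUniserialRing Γ)
    (n : ℕ) (hn : n ≤ 3) (hnΛ : loewyLength Λ = n) (hnΓ : loewyLength Γ = n)
    (hk : Nonempty (IsLocalRing.ResidueField Λ ≃+* IsLocalRing.ResidueField Γ))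
    (Q : Type w) [Quiver.{w'} Q] [Fintype Q] [∀ i j : Q, Fintype (i ⟶ j)]
    (hQ : Quiver.IsAcyclic Q) :
    ∃ φ : QuiverRep.IndecMono Q Λ ≃ QuiverRep.IndecMono Q Γ,
      ∀ x : QuiverRep.IndecMono Q Λ,
        (∃! α : Q → List ℕ, x.HasPartitionVector α) ∧
          ∀ α : Q → List ℕ, x.HasPartitionVector α ↔ (φ x).HasPartitionVector α := by
  obtain ⟨ε⟩ := hk
  obtain ⟨ϖ, hR⟩ := hΛ.exists_isChainRing (RingEquiv.refl (IsLocalRing.ResidueField Λ))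
  -- Both residue maps are made to land in the residue field of `Λ`, so that invariants over the two
  -- rings are linear algebra over one field.
  obtain ⟨ϖ', hS⟩ := hΓ.exists_isChainRing ε.symm
  rw [hnΛ] at hR
  rw [hnΓ] at hS
  choose f hf hMf using fun M : QuiverRep Q Λ => StablyAlike.exists_isMono hn hQ hR hS M
  choose g hg hNg using fun N : QuiverRep Q Γ => StablyAlike.exists_isMono hn hQ hS hR N
  let F (M : {M : QuiverRep Q Λ // M.IsIndecomposableMono}) :
      {N : QuiverRep Q Γ // N.IsIndecomposableMono} :=
    ⟨f M.1, (hMf M.1).isIndecomposableMono hn hQ hR hS M.2 (hf M.1)⟩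
  let G (N : {N : QuiverRep Q Γ // N.IsIndecomposableMono}) :
      {M : QuiverRep Q Λ // M.IsIndecomposableMono} :=
    ⟨g N.1, (hNg N.1).isIndecomposableMono hn hQ hS hR N.2 (hg N.1)⟩
  let φ : QuiverRep.IndecMono Q Λ ≃ QuiverRep.IndecMono Q Γ :=
    { toFun := Quotient.map' F fun M M' e =>
        StablyAlike.nonempty_iso hn hQ hR hS (hf M.1) (hf M'.1) (hMf M.1) (hMf M'.1) e
      invFun := Quotient.map' G fun N N' e =>
        StablyAlike.nonempty_iso hn hQ hS hR (hg N.1) (hg N'.1) (hNg N.1) (hNg N'.1) e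
      left_inv := by
        rintro ⟨M⟩
        -- `G (F M)` and `M` both have the invariants of `F M`, hence are isomorphic.
        exact Quotient.sound (StablyAlike.nonempty_iso hn hQ hS hR (hg _) M.2.1 (hNg _)
          (hMf M.1).symm ((QuiverRep.indecMonoSetoid Q Γ).refl (F M)))
      right_inv := by
        rintro ⟨N⟩
        exact Quotient.sound (StablyAlike.nonempty_iso hn hQ hR hS (hf _) N.2.1 (hMf _)
          (hNg N.1).symm ((QuiverRep.indecMonoSetoid Q Λ).refl (G N))) }
  refine ⟨φ, ?_⟩
  rintro ⟨M⟩
  constructor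
  · choose α hα using fun i => hR.exists_hasPartition (M.1.obj i)
    refine ⟨α, (QuiverRep.IndecMono.hasPartitionVector_mk M α).2 hα, fun β hβ => ?_⟩
    exact funext fun i => hR.hasPartition_unique
      ((QuiverRep.IndecMono.hasPartitionVector_mk M β).1 hβ i) (hα i)
  · intro α
    refine (QuiverRep.IndecMono.hasPartitionVector_mk M α).trans (Iff.trans ?_
      (QuiverRep.IndecMono.hasPartitionVector_mk (F M) α).symm)
    exact forall_congr' fun i =>
      ⟨(hMf M.1).hasPartition hn hQ hR hS M.2.1 (hf M.1),
        (hMf M.1).symm.hasPartition hn hQ hS hR (hf M.1) M.2.1⟩
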